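/- Notation. $L^p=L^p(\mathbb R^3;\mathbb C)$, $H^2=W^{2,2}(\mathbb R^3;\mathbb C)$ (weak derivatives up to order two in $L^2$), and for $\boldsymbol\psi=(\psi_1,\dots,\psi_N):\mathbb R^3\to\mathbb C^N$, $|\boldsymbol\psi|^2=\sum_{j=1}^N|\psi_j|^2$, $$\|\boldsymbol\psi\|_{(L^p)^N}=\big\|\,|\boldsymbol\psi|\,\big\|_{L^p},\qquad \|\psi_j\|_{H^2}^2=\|\psi_j\|_{L^2}^2+\|\Delta\psi_j\|_{L^2}^2,\qquad \|\boldsymbol\psi\|_{(H^2)^N}^2=\sum_{j=1}^N\|\psi_j\|_{H^2}^2 .$$ For $q\ge 1$ and $\lambda\in\mathbb R$ write $F_{q,\lambda}(\boldsymbol\psi)=\lambda\rho^{q-1}\boldsymbol\psi=\lambda|\boldsymbol\psi|^{2(q-1)}\boldsymbol\psi$, where $\rho=|\boldsymbol\psi|^2$ (with $0^0=1$). Lemma (Lipschitz estimates on the local non-linearity). (D) Let $q\in[1,\infty)$ and $\lambda\in\mathbb R$. There is a constant $0<C_{q,\lambda}<\infty$, depending only on $q$ and $\lambda$, such that for all $N$,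 all $p\in[1,\infty]$ and all $\boldsymbol\psi,\boldsymbol\psi'\in(H^2)^N\cap(L^p)^N$ we have $F_{q,\lambda}(\boldsymbol\psi),F_{q,\lambda}(\boldsymbol\psi')\in(L^p)^N$ and $$\|F_{q,\lambda}(\boldsymbol\psi)-F_{q,\lambda}(\boldsymbol\psi')\|_{(L^p)^N}\le C_{q,\lambda}\,N^{\max\{q-2,0\}}\sum_{j=1}^N\Big[\|\psi_j\|_{H^2}^{2(q-1)}+\|\psi'_j\|_{H^2}^{2(q-1)}\Big]\,\|\boldsymbol\psi-\boldsymbol\psi'\|_{(L^p)^N}.$$ (E) Let $q\ge 7/2$ and $\lambda\in\mathbb R$. There is a non-decreasing function $\mathcal L_{q,\lambda}:[0,\infty)\to[0,\infty)$, which vanishes at the origin and only there, such that for all $N$ and all $\boldsymbol\psi,\boldsymbol\psi'\in(H^2)^N$ we have $F_{q,\lambda}(\boldsymbol\psi),F_{q,\lambda}(\boldsymbol\psi')\in(H^2)^N$ and $$\|F_{q,\lambda}(\boldsymbol\psi)-F_{q,\lambda}(\boldsymbol\psi')\|_{(H^2)^N}\le \mathcal L_{q,\lambda}\big(\max\{\|\boldsymbol\psi\|_{(H^2)^N},\|\boldsymbol\psi'\|_{(H^2)^N}\}\big)\,\|\boldsymbol\psi-\boldsymbol\psi'\|_{(H^2)^N}.$$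 -/

import Mathlib

open MeasureTheory
open scoped ENNReal

noncomputable section

/-- Physical space `ℝ³` with its Euclidean norm (and Lebesgue measure `volume`). -/
abbrev R3 : Type := EuclideanSpace ℝ (Fin 3)

/-- Test functions on `ℝ³`: real-valued, smooth and compactly supported. -/
def IsTestFunction (φ : R3 → ℝ) : Prop :=
  ContDiff ℝ (⊤ : ℕ∞) φ ∧ HasCompactSupport φ

/-- `g` is the weak partial derivative `∂ᵢ f`: both are locally integrable and
`∫ (∂ᵢ φ) f = - ∫ φ g` for all test functions `φ`. -/
def IsWeakPartial (i : Fin 3) (f g : R3 → ℂ) : Prop :=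
  LocallyIntegrable f ∧ LocallyIntegrable g ∧
    ∀ φ : R3 → ℝ, IsTestFunction φ →
      ∫ x, (fderiv ℝ φ x (EuclideanSpace.single i 1)) • f x = - ∫ x, φ x • g x

/-- `g` is the weak Laplacian `Δ f`: both are locally integrable and
`∫ (Δ φ) f = ∫ φ g` for all test functions `φ`. -/
def IsWeakLaplacian (f g : R3 → ℂ) : Prop :=
  LocallyIntegrable f ∧ LocallyIntegrable g ∧
    ∀ φ : R3 → ℝ, IsTestFunction φ →
      ∫ x, (Laplacian.laplacian φ x) • f x = ∫ x, φ x • g x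

open Classical in
/-- A representative of the weak Laplacian of `f` (unique up to null sets), and `0` if `f` has
no weak Laplacian. -/
def weakLaplacian (f : R3 → ℂ) : R3 → ℂ :=
  if h : ∃ g, IsWeakLaplacian f g then h.choose else 0

/-- `f ∈ H² = W^{2,2}(ℝ³; ℂ)`: `f` and all its weak partial derivatives of first and second
order are in `L²`. -/
def MemH2 (f : R3 → ℂ) : Prop :=
  MemLp f 2 ∧
    ∃ (g : Fin 3 → R3 → ℂ) (h : Fin 3 → Fin 3 → R3 → ℂ),
      (∀ i, MemLp (g i) 2 ∧ IsWeakPartial i f (g i)) ∧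
      (∀ i j, MemLp (h i j) 2 ∧ IsWeakPartial j (g i) (h i j))

/-- The norm of `(L^p)^N`, i.e. the `L^p` norm of the pointwise Euclidean norm
(meaningful on functions with `MemLp ψ p`). -/
def normLp {N : ℕ} (p : ℝ≥0∞) (ψ : R3 → EuclideanSpace ℂ (Fin N)) : ℝ :=
  (eLpNorm ψ p volume).toReal

/-- The norm `‖f‖_{H²} = (‖f‖_{L²}² + ‖Δf‖_{L²}²)^{1/2}` (meaningful on functions with
`MemH2 f`). -/
def normH2 (f : R3 → ℂ) : ℝ :=
  Real.sqrt ((eLpNorm f 2 volume).toReal ^ 2 + (eLpNorm (weakLaplacian f) 2 volume).toReal ^ 2)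

/-- `ψ ∈ (H²)^N`. -/
def MemH2Vec {N : ℕ} (ψ : R3 → EuclideanSpace ℂ (Fin N)) : Prop :=
  ∀ j, MemH2 (fun x => ψ x j)

/-- The norm `‖ψ‖_{(H²)^N} = (∑ⱼ ‖ψⱼ‖_{H²}²)^{1/2}`. -/
def normH2Vec {N : ℕ} (ψ : R3 → EuclideanSpace ℂ (Fin N)) : ℝ :=
  Real.sqrt (∑ j, normH2 (fun x => ψ x j) ^ 2)

/-- The density `ρ = ∑ⱼ |ψⱼ|²`. -/
def density {N : ℕ} (ψ : R3 → EuclideanSpace ℂ (Fin N)) (x : R3) : ℝ :=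
  ∑ j, ‖ψ x j‖ ^ 2

/-- The local exchange potential `v_x[ρ] = λ ρ^{q-1}`. -/
def exchangePotential (q lam : ℝ) (ρ : R3 → ℝ) (x : R3) : ℝ :=
  lam * ρ x ^ (q - 1)

/-- The local non-linearity `ψ ↦ v_x[ρ] ψ = λ |ψ|^{2(q-1)} ψ`. -/
def localNonlinearity {N : ℕ} (q lam : ℝ) (ψ : R3 → EuclideanSpace ℂ (Fin N)) :
    R3 → EuclideanSpace ℂ (Fin N) :=
  fun x => exchangePotential q lam (density ψ) x • ψ x

end

/-! Put b = 2(q-1) and F(z) = |z|^b z, so that the non-linearity is λF(ψ). Everything rests on the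
embeddings H² ⊂ L^∞ and ∇H² ⊂ L⁴, with one constant for all N (`exists_h2Vec_bounds`). For Schwartz
functions the first holds because (1+|ξ|²)⁻¹ is square integrable in dimension three, which puts the
Fourier transform in L¹ (`exists_norm_le_l2`). The second is the Gagliardo–Nirenberg inequality
‖∂f‖₄² ≤ 3‖f‖_∞‖∂²f‖₂, got by integrating ∫|∂f|⁴ by parts (`integral_norm_pow_four_le`). Density of
Schwartz functions (`exists_schwartz_approx`) and Fatou carry both to H².

Part (D) is pointwise: |F(z)-F(w)| ≤ (b+2)(|z|^b+|w|^b)|z-w|. The sup bound on each component and an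
inequality for powers of sums produce the factor N^max(q-2,0). What remains is a constant times
|ψ-ψ'|, and this passes to every L^p.

For part (E) the chain rule (`HasH2DerivsVec.norm_rpow_smul`) gives ΔF(ψ) = DF(ψ)Δψ + ∑ᵢ
D²F(ψ)(∂ᵢψ,∂ᵢψ). Differences are estimated with L² norms on the Laplacians, L⁴ norms on each of the
two gradients and sup norms elsewhere (`normH2Vec_norm_rpow_smul_sub_le`). The formula for D²F
contains |z|^(b-4), and the Lipschitz bound for |z|^s needs s ≥ 1; hence b ≥ 5, that is q ≥ 7/2. All
bounds are homogeneous of degree b, so the Lipschitz function is a multiple of s^b. -/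

section
-- Weak derivatives tested against Schwartz functions.
open Filter Topology
open scoped SchwartzMap LineDeriv

/-- The standard basis vectors. -/
noncomputable abbrev basisVec (i : Fin 3) : R3 := EuclideanSpace.single i 1

theorem integrable_smul_of_memLp_two {G : Type*} [NormedAddCommGroup G] [NormedSpace ℝ G]
    {φ : R3 → ℝ} {f : R3 → G} (hφ : Continuous φ) (hc : HasCompactSupport φ) (hf : MemLp f 2) :
    Integrable (fun x => φ x • f x) :=
  (hf.locallyIntegrable (by norm_num)).integrable_smul_left_of_hasCompactSupport hφ hc

theorem IsTestFunction.fderiv_apply {φ : R3 → ℝ} (hφ : IsTestFunction φ) (v : R3) :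
    IsTestFunction (fun x => fderiv ℝ φ x v) := by
  refine ⟨?_, ?_⟩
  · have : ContDiff ℝ (⊤ : ℕ∞) (fderiv ℝ φ) := hφ.1.fderiv_right (by simp)
    exact this.clm_apply contDiff_const
  · exact hφ.2.fderiv_apply ℝ v

/-- Weak derivatives are defined by real test functions; splitting into real and imaginary parts
allows complex ones. -/
theorem IsWeakPartial.integral_complex_compactSupport {i : Fin 3} {f g : R3 → ℂ} (h : IsWeakPartial i f g)
    (hf : MemLp f 2) (hg : MemLp g 2)
    {φ : R3 → ℂ} (hφ : ContDiff ℝ (⊤ : ℕ∞) φ) (hc : HasCompactSupport φ) :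
    ∫ x, (fderiv ℝ φ x (basisVec i)) * f x = - ∫ x, φ x * g x := by
  have hre : IsTestFunction (fun x => (φ x).re) :=
    ⟨Complex.reCLM.contDiff.comp hφ, hc.comp_left (g := Complex.re) rfl⟩
  have him : IsTestFunction (fun x => (φ x).im) :=
    ⟨Complex.imCLM.contDiff.comp hφ, hc.comp_left (g := Complex.im) rfl⟩
  have hd : Differentiable ℝ φ := hφ.differentiable (by simp)
  have dre : ∀ x, fderiv ℝ (fun x => (φ x).re) x (basisVec i) = (fderiv ℝ φ x (basisVec i)).re := by
    intro x
    have := (Complex.reCLM.hasFDerivAt.comp x (hd x).hasFDerivAt).fderiv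
    exact congrArg (fun L => L (basisVec i)) this
  have dim : ∀ x, fderiv ℝ (fun x => (φ x).im) x (basisVec i) = (fderiv ℝ φ x (basisVec i)).im := by
    intro x
    have := (Complex.imCLM.hasFDerivAt.comp x (hd x).hasFDerivAt).fderiv
    exact congrArg (fun L => L (basisVec i)) this
  have e1 := h.2.2 _ hre
  have e2 := h.2.2 _ him
  have i1 := integrable_smul_of_memLp_two hre.1.continuous hre.2 hg
  have i2 := integrable_smul_of_memLp_two him.1.continuous him.2 hg
  have j1 := integrable_smul_of_memLp_two (hre.fderiv_apply (basisVec i)).1.continuous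
    (hre.fderiv_apply (basisVec i)).2 hf
  have j2 := integrable_smul_of_memLp_two (him.fderiv_apply (basisVec i)).1.continuous
    (him.fderiv_apply (basisVec i)).2 hf
  have split : ∀ z w : ℂ, z * w = z.re • w + Complex.I * (z.im • w) := by
    intro z w
    conv_lhs => rw [← Complex.re_add_im z]
    simp only [Complex.real_smul]; ring
  calc ∫ x, (fderiv ℝ φ x (basisVec i)) * f x
      = ∫ x, (fderiv ℝ (fun x => (φ x).re) x (basisVec i) • f x
        + Complex.I * (fderiv ℝ (fun x => (φ x).im) x (basisVec i) • f x)) := by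
        congr 1; ext x; rw [split, dre, dim]
    _ = - ∫ x, ((φ x).re • g x + Complex.I * ((φ x).im • g x)) := by
        rw [integral_add j1 (j2.const_mul _), integral_const_mul, e1, e2,
          integral_add i1 (i2.const_mul _), integral_const_mul]
        ring
    _ = _ := by congr 2; ext x; rw [split (φ x)]

theorem integrable_schwartz_mul (φ : 𝓢(R3, ℂ)) {f : R3 → ℂ} (hf : MemLp f 2) :
    Integrable (fun x => φ x * f x) :=
  (φ.memLp 2).integrable_mul hf

/-- Multiply `φ` by the dilated bump `b (c n • x)` with `c n → 0`. The derivative falling on the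
bump costs a term of size O(`c n`), and dominated convergence removes the cutoff. Weak derivatives
thus become derivatives of tempered distributions. -/
theorem IsWeakPartial.integral_schwartz {i : Fin 3} {f g : R3 → ℂ} (h : IsWeakPartial i f g)
    (hf : MemLp f 2) (hg : MemLp g 2) (φ : 𝓢(R3, ℂ)) :
    ∫ x, (∂_{basisVec i} φ) x * f x = - ∫ x, φ x * g x := by
  let b : ContDiffBump (0 : R3) := ⟨1, 2, by norm_num, by norm_num⟩
  have hb : ContDiff ℝ (⊤ : ℕ∞) b := b.contDiff
  obtain ⟨C, hC⟩ : ∃ C, ∀ x, ‖fderiv ℝ b x‖ ≤ C :=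
    (b.hasCompactSupport.fderiv ℝ).exists_bound_of_continuous (hb.continuous_fderiv (by simp))
  have hC0 : 0 ≤ C := (norm_nonneg _).trans (hC 0)
  let c : ℕ → ℝ := fun n => 1 / ((n : ℝ) + 1)
  have hc0 : ∀ n, 0 < c n := fun n => by positivity
  have hc1 : ∀ n, c n ≤ 1 := fun n => by
    simp only [c]; rw [div_le_one (by positivity)]; linarith [(Nat.cast_nonneg n : (0:ℝ) ≤ n)]
  have hct : Tendsto c atTop (𝓝 0) := tendsto_one_div_add_atTop_nhds_zero_nat
  let χ : ℕ → R3 → ℝ := fun n x => b (c n • x)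
  have hχs : ∀ n, ContDiff ℝ (⊤ : ℕ∞) (χ n) := fun n => hb.comp (contDiff_const_smul _)
  have hχc : ∀ n, HasCompactSupport (χ n) := fun n =>
    b.hasCompactSupport.comp_homeomorph (Homeomorph.smulOfNeZero (c n) (hc0 n).ne')
  have hχd : ∀ n x v, fderiv ℝ (χ n) x v = c n * fderiv ℝ b (c n • x) v := by
    intro n x v
    have h1 : HasFDerivAt (χ n) ((fderiv ℝ b (c n • x)).comp (c n • ContinuousLinearMap.id ℝ R3)) x := by
      exact ((hb.differentiable (by simp)) _).hasFDerivAt.comp x ((hasFDerivAt_id x).const_smul (c n))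
    rw [h1.fderiv]; simp
  have hχ1 : ∀ n x, ‖χ n x‖ ≤ 1 := fun n x => by
    rw [Real.norm_of_nonneg b.nonneg]; exact b.le_one
  have hχt : ∀ x, Tendsto (fun n => χ n x) atTop (𝓝 1) := by
    intro x
    have : Tendsto (fun n => χ n x) atTop (𝓝 (b ((0:ℝ) • x))) :=
      (hb.continuous.tendsto _).comp (hct.smul_const x)
    simpa [b.one_of_mem_closedBall (x := 0) (by simp [b])] using this
  have key : ∀ n, ∫ x, ((χ n x : ℂ) * (∂_{basisVec i} φ) x * f x
      + ((c n * fderiv ℝ b (c n • x) (basisVec i) : ℝ) : ℂ) * φ x * f x)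
      = - ∫ x, (χ n x : ℂ) * φ x * g x := by
    intro n
    have hs : ContDiff ℝ (⊤ : ℕ∞) (fun x => χ n x • φ x) := (hχs n).smul (φ.smooth ⊤)
    have hcs : HasCompactSupport (fun x => χ n x • φ x) := (hχc n).smul_right
    have := h.integral_complex_compactSupport hf hg hs hcs
    have hx : ∀ x, (fderiv ℝ (fun x => χ n x • φ x) x (basisVec i)) * f x
        = (χ n x : ℂ) * (∂_{basisVec i} φ) x * f x
          + ((c n * fderiv ℝ b (c n • x) (basisVec i) : ℝ) : ℂ) * φ x * f x := by
      intro x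
      have hd := (((hχs n).differentiable (by simp) x).hasFDerivAt.smul (φ.hasFDerivAt x)).fderiv
      have hd' : fderiv ℝ (fun x => χ n x • φ x) x (basisVec i) = χ n x • fderiv ℝ φ x (basisVec i)
          + (fderiv ℝ (χ n) x (basisVec i)) • φ x :=
        congrArg (fun L => L (basisVec i)) hd
      rw [hd', hχd, SchwartzMap.lineDerivOp_apply_eq_fderiv]
      simp only [Complex.real_smul]
      ring
    simp only [hx] at this
    simp only [Complex.real_smul] at this
    exact this
  have I1 := integrable_schwartz_mul (∂_{basisVec i} φ) hf
  have I2 := integrable_schwartz_mul φ hf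
  have I3 := integrable_schwartz_mul φ hg
  have hbv : ‖basisVec i‖ = 1 := by simp [basisVec]
  have hbd : ∀ n x, ‖c n * fderiv ℝ b (c n • x) (basisVec i)‖ ≤ c n * C := by
    intro n x
    rw [norm_mul, Real.norm_of_nonneg (hc0 n).le]
    refine mul_le_mul_of_nonneg_left ?_ (hc0 n).le
    calc _ ≤ ‖fderiv ℝ b (c n • x)‖ * ‖basisVec i‖ := ContinuousLinearMap.le_opNorm _ _
      _ ≤ C := by rw [hbv, mul_one]; exact hC _
  have T1 : Tendsto (fun n => ∫ x, ((χ n x : ℂ) * (∂_{basisVec i} φ) x * f x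
      + ((c n * fderiv ℝ b (c n • x) (basisVec i) : ℝ) : ℂ) * φ x * f x)) atTop
      (𝓝 (∫ x, (∂_{basisVec i} φ) x * f x)) := by
    apply tendsto_integral_of_dominated_convergence
      (fun x => ‖(∂_{basisVec i} φ) x * f x‖ + C * ‖φ x * f x‖)
    · intro n
      apply AEStronglyMeasurable.add
      · exact ((Complex.continuous_ofReal.comp (hχs n).continuous).mul
          (SchwartzMap.continuous _)).aestronglyMeasurable.mul hf.1
      · refine (Continuous.aestronglyMeasurable ?_).mul hf.1
        refine (Complex.continuous_ofReal.comp ?_).mul φ.continuous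
        have := (hb.continuous_fderiv (by simp))
        fun_prop
    · exact I1.norm.add (I2.norm.const_mul C)
    · intro n
      filter_upwards with x
      refine (norm_add_le _ _).trans (add_le_add ?_ ?_)
      · rw [mul_assoc, norm_mul, Complex.norm_real]
        exact mul_le_of_le_one_left (norm_nonneg _) (hχ1 n x)
      · rw [mul_assoc, norm_mul, Complex.norm_real]
        refine mul_le_mul_of_nonneg_right ((hbd n x).trans ?_) (norm_nonneg _)
        exact mul_le_of_le_one_left hC0 (hc1 n)
    · filter_upwards with x
      have t1 : Tendsto (fun n => (χ n x : ℂ)) atTop (𝓝 1) := by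
        exact_mod_cast (Complex.continuous_ofReal.tendsto 1).comp (hχt x)
      have t2 : Tendsto (fun n => ((c n * fderiv ℝ b (c n • x) (basisVec i) : ℝ) : ℂ)) atTop (𝓝 0) := by
        have : Tendsto (fun n => c n * fderiv ℝ b (c n • x) (basisVec i)) atTop (𝓝 0) :=
          squeeze_zero_norm (fun n => hbd n x) (by simpa using hct.mul_const C)
        exact_mod_cast (Complex.continuous_ofReal.tendsto 0).comp this
      have := ((t1.mul_const ((∂_{basisVec i} φ) x)).mul_const (f x)).add
        ((t2.mul_const (φ x)).mul_const (f x))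
      simpa using this
  have T2 : Tendsto (fun n => - ∫ x, (χ n x : ℂ) * φ x * g x) atTop (𝓝 (- ∫ x, φ x * g x)) := by
    apply Tendsto.neg
    apply tendsto_integral_of_dominated_convergence (fun x => ‖φ x * g x‖)
    · intro n
      exact ((Complex.continuous_ofReal.comp (hχs n).continuous).mul
          (SchwartzMap.continuous _)).aestronglyMeasurable.mul hg.1
    · exact I3.norm
    · intro n
      filter_upwards with x
      rw [mul_assoc, norm_mul, Complex.norm_real]
      exact mul_le_of_le_one_left (norm_nonneg _) (hχ1 n x)
    · filter_upwards with x
      have t1 : Tendsto (fun n => (χ n x : ℂ)) atTop (𝓝 1) := by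
        exact_mod_cast (Complex.continuous_ofReal.tendsto 1).comp (hχt x)
      simpa using (t1.mul_const (φ x)).mul_const (g x)
  exact tendsto_nhds_unique (T1.congr key) T2

end

/-! ### Density of Schwartz functions in H² by Fourier multipliers. -/

section
open Filter Topology
open scoped SchwartzMap LineDeriv FourierTransform Real

/-- The Hilbert space `L²(ℝ³; ℂ)`. -/
abbrev L2R3 : Type := Lp ℂ 2 (volume : Measure R3)

/-- The tempered distribution defined by an `L²` function. -/
noncomputable def distL2 : L2R3 →L[ℂ] 𝓢'(R3, ℂ) := Lp.toTemperedDistributionCLM ℂ volume 2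

theorem distL2_injective : Function.Injective distL2 :=
  LinearMap.ker_eq_bot.mp
    (Lp.ker_toTemperedDistributionCLM_eq_bot (F := ℂ) (μ := (volume : Measure R3)) (p := 2))

theorem distL2_toLp (f : 𝓢(R3, ℂ)) :
    distL2 (f.toLp 2 volume) = SchwartzMap.toTemperedDistributionCLM R3 ℂ volume f :=
  Lp.toTemperedDistribution_toLp_eq f

theorem distL2_multiplier_schwartz {m : R3 → ℂ} (hm : m.HasTemperateGrowth) (f : 𝓢(R3, ℂ)) :
    TemperedDistribution.fourierMultiplierCLM ℂ m (distL2 (f.toLp 2 volume))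
      = distL2 ((SchwartzMap.fourierMultiplierCLM ℂ m f).toLp 2 volume) := by
  rw [distL2_toLp, distL2_toLp]
  exact TemperedDistribution.fourierMultiplierCLM_toTemperedDistributionCLM_eq hm f

theorem distL2_lineDeriv_schwartz (v : R3) (f : 𝓢(R3, ℂ)) :
    ∂_{v} (distL2 (f.toLp 2 volume)) = distL2 ((∂_{v} f).toLp 2 volume) := by
  rw [distL2_toLp, distL2_toLp]
  exact TemperedDistribution.lineDerivOp_toTemperedDistributionCLM_eq f v

/-- Plancherel: a symbol bounded by `C` acts on L² with norm at most `C`, although the multiplier is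
a priori defined only on tempered distributions. -/
theorem exists_distL2_multiplier {m : R3 → ℂ} (hm : m.HasTemperateGrowth) {C : ℝ}
    (hC : ∀ x, ‖m x‖ ≤ C) (u : L2R3) :
    ∃ v : L2R3, TemperedDistribution.fourierMultiplierCLM ℂ m (distL2 u) = distL2 v ∧
      ‖v‖ ≤ C * ‖u‖ := by
  have hmL : MemLp m ⊤ (volume : Measure R3) :=
    memLp_top_of_bound hm.1.continuous.aestronglyMeasurable C (ae_of_all _ hC)
  have hC0 : 0 ≤ C := (norm_nonneg _).trans (hC 0)
  have hn : ‖hmL.toLp m‖ ≤ C := by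
    rw [Lp.norm_toLp]
    refine ENNReal.toReal_le_of_le_ofReal hC0 ?_
    rw [eLpNorm_exponent_top]
    exact eLpNormEssSup_le_of_ae_bound (ae_of_all _ hC)
  refine ⟨𝓕⁻ ((hmL.toLp m • (𝓕 u : L2R3) : L2R3)), ?_, ?_⟩
  · change TemperedDistribution.fourierMultiplierCLM ℂ m (Lp.toTemperedDistribution u)
      = Lp.toTemperedDistribution _
    rw [TemperedDistribution.fourierMultiplierCLM_apply, Lp.fourier_toTemperedDistribution_eq,
      ← Lp.toTemperedDistribution_smul_eq (r := 2) hm hmL, Lp.fourierInv_toTemperedDistribution_eq]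
  · rw [← Lp.norm_fourier_eq, FourierTransform.fourier_fourierInv_eq]
    refine (Lp.norm_smul_le _ _).trans ?_
    rw [Lp.norm_fourier_eq]
    exact mul_le_mul_of_nonneg_right hn (norm_nonneg _)

/-- By injectivity of `distL2`, `U n - u` is the L² image of `H n - G` under a bounded operator. -/
theorem tendsto_of_distL2_multiplier {m : R3 → ℂ} (hm : m.HasTemperateGrowth) {C : ℝ}
    (hC : ∀ x, ‖m x‖ ≤ C) {G u : L2R3} {H U : ℕ → L2R3} (hH : Tendsto H atTop (𝓝 G))
    (hu : TemperedDistribution.fourierMultiplierCLM ℂ m (distL2 G) = distL2 u)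
    (hU : ∀ n, TemperedDistribution.fourierMultiplierCLM ℂ m (distL2 (H n)) = distL2 (U n)) :
    Tendsto U atTop (𝓝 u) := by
  rw [tendsto_iff_norm_sub_tendsto_zero] at hH ⊢
  refine squeeze_zero (fun n => norm_nonneg _) (fun n => ?_) (by simpa using hH.const_mul C)
  obtain ⟨v, hv, hvn⟩ := exists_distL2_multiplier hm hC (H n - G)
  have : v = U n - u := by
    apply distL2_injective
    rw [← hv, map_sub, map_sub, map_sub, hu, hU]
  rw [← this]; exact hvn

theorem IsWeakPartial.lineDeriv_distL2 {i : Fin 3} {f g : R3 → ℂ} (h : IsWeakPartial i f g)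
    (hf : MemLp f 2) (hg : MemLp g 2) :
    ∂_{basisVec i} (distL2 (hf.toLp f)) = distL2 (hg.toLp g) := by
  ext φ
  change ∂_{basisVec i} (Lp.toTemperedDistribution (hf.toLp f)) φ
    = Lp.toTemperedDistribution (hg.toLp g) φ
  rw [TemperedDistribution.lineDerivOp_apply_apply, Lp.toTemperedDistribution_apply,
    Lp.toTemperedDistribution_apply]
  have e1 : ∫ x, (-∂_{basisVec i} φ) x • (hf.toLp f) x = - ∫ x, (∂_{basisVec i} φ) x * f x := by
    rw [← integral_neg]
    apply integral_congr_ae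
    filter_upwards [hf.coeFn_toLp] with x hx
    rw [hx]; simp
  have e2 : ∫ x, φ x • (hg.toLp g) x = ∫ x, φ x * g x := by
    apply integral_congr_ae
    filter_upwards [hg.coeFn_toLp] with x hx
    rw [hx]; simp
  rw [e1, e2, h.integral_schwartz hf hg, neg_neg]

theorem lineDeriv_fourierMultiplier {m : R3 → ℂ} (hm : m.HasTemperateGrowth) (v : R3)
    (T : 𝓢'(R3, ℂ)) :
    ∂_{v} (TemperedDistribution.fourierMultiplierCLM ℂ m T) =
      TemperedDistribution.fourierMultiplierCLM ℂ
        (fun x => (2 * π * Complex.I) * (m x * (inner ℝ x v : ℝ))) T := by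
  have h1 : (fun x : R3 => ((inner ℝ x v : ℝ) : ℂ)).HasTemperateGrowth := by fun_prop
  rw [TemperedDistribution.lineDeriv_eq_fourierMultiplierCLM,
    TemperedDistribution.fourierMultiplierCLM_fourierMultiplierCLM_apply hm h1,
    ← _root_.smul_apply,
    ← TemperedDistribution.fourierMultiplierCLM_smul (hm.mul h1)]
  rfl

/-- The symbol of the resolvent `(1 - (2π)⁻² Δ)⁻¹`. -/
noncomputable def resolventSymbol (x : R3) : ℂ := (((1 + ‖x‖ ^ 2) ^ (-1 : ℝ) : ℝ) : ℂ)

theorem resolventSymbol_hasTemperateGrowth : resolventSymbol.HasTemperateGrowth := by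
  unfold resolventSymbol; fun_prop

theorem norm_resolventSymbol (x : R3) : ‖resolventSymbol x‖ = (1 + ‖x‖ ^ 2)⁻¹ := by
  rw [resolventSymbol, Complex.norm_real, Real.rpow_neg_one, Real.norm_of_nonneg (by positivity)]

/-- The symbol of `1 - (2π)⁻² Δ` is `1 + ‖ξ‖²`, the reciprocal of `resolventSymbol`. Every H²
function is therefore the resolvent of an L² function. -/
theorem resolvent_sub_laplacian (T : 𝓢'(R3, ℂ)) :
    TemperedDistribution.fourierMultiplierCLM ℂ resolventSymbol
      (T - ((((2 * π) ^ 2)⁻¹ : ℝ) : ℂ) • ∑ i, ∂_{basisVec i} (∂_{basisVec i} T)) = T := by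
  have h1 : (fun x : R3 => ((‖x‖ ^ 2 : ℝ) : ℂ)).HasTemperateGrowth := by fun_prop
  have hL : ∑ i, ∂_{basisVec i} (∂_{basisVec i} T) = Laplacian.laplacian T := by
    rw [TemperedDistribution.laplacian_eq_sum (EuclideanSpace.basisFun (Fin 3) ℝ)]
    simp
  rw [hL, TemperedDistribution.laplacian_eq_fourierMultiplierCLM, map_sub, map_smul,
    ContinuousLinearMap.map_smul_of_tower,
    TemperedDistribution.fourierMultiplierCLM_fourierMultiplierCLM_apply h1
      resolventSymbol_hasTemperateGrowth, ← Complex.coe_smul, smul_smul]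
  have hp : ((((2 * π) ^ 2)⁻¹ : ℝ) : ℂ) * ((-(2 * π) ^ 2 : ℝ) : ℂ) = -1 := by
    rw [← Complex.ofReal_mul]
    have : ((2 * π) ^ 2)⁻¹ * (-(2 * π) ^ 2) = -1 := by
      field_simp
    rw [this]; simp
  have hadd := TemperedDistribution.smulLeftCLM_add (F := ℂ) resolventSymbol_hasTemperateGrowth
    (h1.mul resolventSymbol_hasTemperateGrowth)
  have hone : resolventSymbol + (fun x : R3 => ((‖x‖ ^ 2 : ℝ) : ℂ)) * resolventSymbol
      = fun _ => (1 : ℂ) := by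
    ext x
    have : (1 + ‖x‖ ^ 2) ≠ 0 := by positivity
    simp only [Pi.add_apply, Pi.mul_apply, resolventSymbol, Real.rpow_neg_one]
    norm_cast
    field_simp
  have hone' := TemperedDistribution.fourierMultiplierCLM_const (E := R3) (F := ℂ) 1
  rw [hp, neg_one_smul, sub_neg_eq_add, TemperedDistribution.fourierMultiplierCLM_apply,
    TemperedDistribution.fourierMultiplierCLM_apply, ← FourierTransform.fourierInv_add,
    ← _root_.add_apply]
  refine Eq.trans ?_ (show TemperedDistribution.fourierMultiplierCLM ℂ (fun _ : R3 => (1 : ℂ)) T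
    = T by rw [hone', one_smul]; rfl)
  rw [TemperedDistribution.fourierMultiplierCLM_apply, ← hone, ← hadd]

/-- The resolvent gains two derivatives: `‖ξ‖` and `‖ξ‖²` are both at most `1 + ‖ξ‖²`, so the
resolvent followed by one or two derivatives is bounded on L². -/
theorem inner_mul_resolventSymbol_bound {v : R3} (hv : ‖v‖ ≤ 1) (x : R3) :
    ‖(2 * π * Complex.I) * (resolventSymbol x * (inner ℝ x v : ℝ))‖ ≤ 2 * π := by
  have h1 : |inner ℝ x v| ≤ ‖x‖ := (abs_real_inner_le_norm x v).trans
    (mul_le_of_le_one_right (norm_nonneg _) hv)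
  simp only [norm_mul, norm_resolventSymbol, Complex.norm_real, Complex.norm_I, Real.norm_eq_abs, Complex.norm_ofNat,
    abs_of_pos Real.pi_pos, mul_one]
  refine mul_le_of_le_one_right (by positivity) ?_
  rw [inv_mul_le_one₀ (by positivity)]
  nlinarith [sq_nonneg (‖x‖ - 1)]

theorem inner_mul_inner_mul_resolventSymbol_bound {v w : R3} (hv : ‖v‖ ≤ 1) (hw : ‖w‖ ≤ 1)
    (x : R3) :
    ‖(2 * π * Complex.I) * ((2 * π * Complex.I) * (resolventSymbol x * (inner ℝ x v : ℝ)) *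
      (inner ℝ x w : ℝ))‖ ≤ (2 * π) ^ 2 := by
  have h1 : |inner ℝ x v| ≤ ‖x‖ := (abs_real_inner_le_norm x v).trans
    (mul_le_of_le_one_right (norm_nonneg _) hv)
  have h2 : |inner ℝ x w| ≤ ‖x‖ := (abs_real_inner_le_norm x w).trans
    (mul_le_of_le_one_right (norm_nonneg _) hw)
  simp only [norm_mul, norm_resolventSymbol, Complex.norm_real, Complex.norm_I, Real.norm_eq_abs,
    Complex.norm_ofNat, abs_of_pos Real.pi_pos, mul_one]
  have h3 : (1 + ‖x‖ ^ 2)⁻¹ * (|inner ℝ x v| * |inner ℝ x w|) ≤ 1 := by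
    rw [inv_mul_le_one₀ (by positivity)]
    nlinarith [mul_le_mul h1 h2 (abs_nonneg _) (norm_nonneg _)]
  calc _ = (2 * π) ^ 2 * ((1 + ‖x‖ ^ 2)⁻¹ * (|inner ℝ x v| * |inner ℝ x w|)) := by ring
    _ ≤ _ := mul_le_of_le_one_right (by positivity) h3

theorem eLpNorm_sub_tendsto_of_toLp {F : ℕ → 𝓢(R3, ℂ)} {f : R3 → ℂ} (hf : MemLp f 2)
    (h : Tendsto (fun n => (F n).toLp 2 volume) atTop (𝓝 (hf.toLp f))) :
    Tendsto (fun n => eLpNorm (fun x => F n x - f x) 2 volume) atTop (𝓝 0) := by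
  rw [Lp.tendsto_Lp_iff_tendsto_eLpNorm'] at h
  refine h.congr fun n => eLpNorm_congr_ae ?_
  filter_upwards [(F n).coeFn_toLp 2 volume, hf.coeFn_toLp] with x h1 h2
  simp [h1, h2]

/-- Schwartz functions are dense in `H²`. -/
theorem exists_schwartz_approx {f : R3 → ℂ} {g : Fin 3 → R3 → ℂ} {h : Fin 3 → Fin 3 → R3 → ℂ}
    (hf : MemLp f 2) (hg : ∀ i, MemLp (g i) 2 ∧ IsWeakPartial i f (g i))
    (hh : ∀ i j, MemLp (h i j) 2 ∧ IsWeakPartial j (g i) (h i j)) :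
    ∃ F : ℕ → 𝓢(R3, ℂ),
      Tendsto (fun n => eLpNorm (fun x => F n x - f x) 2 volume) atTop (𝓝 0) ∧
      (∀ i, Tendsto (fun n => eLpNorm (fun x => (∂_{basisVec i} (F n)) x - g i x) 2 volume)
        atTop (𝓝 0)) ∧
      (∀ i j, Tendsto (fun n => eLpNorm
        (fun x => (∂_{basisVec j} (∂_{basisVec i} (F n))) x - h i j x) 2 volume) atTop (𝓝 0)) := by
  let uf := hf.toLp f
  let ug := fun i => (hg i).1.toLp (g i)
  let uh := fun i j => (hh i j).1.toLp (h i j)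
  have d1 : ∀ i, ∂_{basisVec i} (distL2 uf) = distL2 (ug i) := fun i =>
    (hg i).2.lineDeriv_distL2 hf (hg i).1
  have d2 : ∀ i j, ∂_{basisVec j} (distL2 (ug i)) = distL2 (uh i j) := fun i j =>
    (hh i j).2.lineDeriv_distL2 (hg i).1 (hh i j).1
  -- `uf` is the resolvent of `G`. Schwartz functions approximating `G` in L² have Schwartz
  -- resolvents, and these approximate `uf` together with all derivatives up to order two.
  let G : L2R3 := uf - ((((2 * π) ^ 2)⁻¹ : ℝ) : ℂ) • ∑ i, uh i i
  have s0 := resolventSymbol_hasTemperateGrowth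
  have hv : ∀ i, ‖basisVec i‖ ≤ 1 := fun i => by simp [basisVec]
  have hG : TemperedDistribution.fourierMultiplierCLM ℂ resolventSymbol (distL2 G) = distL2 uf := by
    have := resolvent_sub_laplacian (distL2 uf)
    simp only [d1, d2] at this
    rw [← this]
    simp only [G, map_sub, map_smul, map_sum]
  have s1 : ∀ v : R3, (fun x => (2 * π * Complex.I) *
      (resolventSymbol x * (inner ℝ x v : ℝ))).HasTemperateGrowth := fun v => by fun_prop
  obtain ⟨H, hH⟩ : ∃ H : ℕ → 𝓢(R3, ℂ), Tendsto (fun n => (H n).toLp 2 volume) atTop (𝓝 G) := by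
    obtain ⟨s, hs, hst⟩ := mem_closure_iff_seq_limit.mp
      ((SchwartzMap.denseRange_toLpCLM (E := R3) (F := ℂ) (p := 2) (μ := volume) (by simp)) G)
    choose H hH using hs
    exact ⟨H, hst.congr fun n => (hH n).symm⟩
  let F : ℕ → 𝓢(R3, ℂ) := fun n => SchwartzMap.fourierMultiplierCLM ℂ resolventSymbol (H n)
  have e0 : ∀ n, TemperedDistribution.fourierMultiplierCLM ℂ resolventSymbol
      (distL2 ((H n).toLp 2 volume)) = distL2 ((F n).toLp 2 volume) := fun n =>
    distL2_multiplier_schwartz s0 (H n)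
  refine ⟨F, ?_, fun i => ?_, fun i j => ?_⟩
  · apply eLpNorm_sub_tendsto_of_toLp hf
    refine tendsto_of_distL2_multiplier s0 (C := 1) (fun x => ?_) hH hG e0
    rw [norm_resolventSymbol]
    exact inv_le_one_of_one_le₀ (by nlinarith [sq_nonneg ‖x‖])
  · apply eLpNorm_sub_tendsto_of_toLp (hg i).1
    refine tendsto_of_distL2_multiplier (s1 (basisVec i))
      (inner_mul_resolventSymbol_bound (hv i)) hH ?_ fun n => ?_
    · rw [← lineDeriv_fourierMultiplier s0, hG, d1]
    · rw [← lineDeriv_fourierMultiplier s0, e0, distL2_lineDeriv_schwartz]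
  · apply eLpNorm_sub_tendsto_of_toLp (hh i j).1
    refine tendsto_of_distL2_multiplier (by fun_prop)
      (inner_mul_inner_mul_resolventSymbol_bound (hv i) (hv j)) hH ?_ fun n => ?_
    · rw [← lineDeriv_fourierMultiplier (s1 (basisVec i)), ← lineDeriv_fourierMultiplier s0, hG,
        d1, d2]
    · rw [← lineDeriv_fourierMultiplier (s1 (basisVec i)), ← lineDeriv_fourierMultiplier s0, e0,
        distL2_lineDeriv_schwartz, distL2_lineDeriv_schwartz]

end

/-! ### A priori estimates for Schwartz functions. -/

section
open Filter Topology
open scoped SchwartzMap LineDeriv FourierTransform Real ComplexConjugate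

/-- The `L²` norm as a real number. -/
noncomputable def l2 {G : Type*} [NormedAddCommGroup G] (f : R3 → G) : ℝ :=
  (eLpNorm f 2 volume).toReal

theorem l2_nonneg {G : Type*} [NormedAddCommGroup G] (f : R3 → G) : 0 ≤ l2 f :=
  ENNReal.toReal_nonneg

theorem l2_sq {G : Type*} [NormedAddCommGroup G] {f : R3 → G} (hf : MemLp f 2) :
    l2 f ^ 2 = ∫ x, ‖f x‖ ^ 2 := by
  have h0 : 0 ≤ ∫ x, ‖f x‖ ^ 2 := integral_nonneg fun x => by positivity
  rw [l2, hf.eLpNorm_eq_integral_rpow_norm (by norm_num) (by norm_num)]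
  simp only [ENNReal.toReal_ofNat, Real.rpow_ofNat]
  rw [ENNReal.toReal_ofReal (by positivity), ← Real.rpow_natCast, ← Real.rpow_mul h0]
  norm_num

theorem eLpNorm_schwartz_ne_top (f : 𝓢(R3, ℂ)) : eLpNorm f 2 volume ≠ ⊤ :=
  (f.memLp 2 volume).2.ne

/-- The Laplacian of a Schwartz function. -/
noncomputable def schwartzLaplacian (f : 𝓢(R3, ℂ)) : 𝓢(R3, ℂ) :=
  ∑ i, ∂_{basisVec i} (∂_{basisVec i} f)

theorem fourierInv_lineDeriv_apply (f : 𝓢(R3, ℂ)) (v ξ : R3) :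
    (𝓕⁻ (∂_{v} f) : 𝓢(R3, ℂ)) ξ = -(2 * π * Complex.I) * ((inner ℝ ξ v : ℝ) * (𝓕⁻ f : 𝓢(R3, ℂ)) ξ) := by
  rw [SchwartzMap.fourierInv_lineDerivOp_eq]
  have h : (fun x : R3 => inner ℝ x v).HasTemperateGrowth := by fun_prop
  simp [SchwartzMap.smulLeftCLM_apply_apply h]

theorem fourierInv_lineDeriv_lineDeriv_apply (f : 𝓢(R3, ℂ)) (v ξ : R3) :
    (𝓕⁻ (∂_{v} (∂_{v} f) : 𝓢(R3, ℂ)) : 𝓢(R3, ℂ)) ξ = -(2 * π) ^ 2 * ((inner ℝ ξ v : ℝ) ^ 2 * (𝓕⁻ f : 𝓢(R3, ℂ)) ξ) := by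
  rw [fourierInv_lineDeriv_apply, fourierInv_lineDeriv_apply]
  linear_combination (2 * π) ^ 2 * ((inner ℝ ξ v : ℝ) ^ 2 * (𝓕⁻ f : 𝓢(R3, ℂ)) ξ) * Complex.I_sq

theorem fourierInv_schwartzLaplacian_apply (f : 𝓢(R3, ℂ)) (ξ : R3) :
    (𝓕⁻ (schwartzLaplacian f) : 𝓢(R3, ℂ)) ξ = -(2 * π) ^ 2 * ((‖ξ‖ ^ 2 : ℝ) * (𝓕⁻ f : 𝓢(R3, ℂ)) ξ) := by
  have h1 : 𝓕⁻ (schwartzLaplacian f) = ∑ i, 𝓕⁻ (∂_{basisVec i} (∂_{basisVec i} f)) :=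
    map_sum (FourierTransform.fourierInvCLM ℂ 𝓢(R3, ℂ)) _ _
  have h2 : ∑ i, (inner ℝ ξ (basisVec i)) ^ 2 = ‖ξ‖ ^ 2 := by
    simpa using (EuclideanSpace.basisFun (Fin 3) ℝ).sum_sq_inner_left ξ
  rw [h1, _root_.sum_apply]
  simp only [fourierInv_lineDeriv_lineDeriv_apply]
  rw [← h2, ← Finset.mul_sum]
  push_cast
  rw [← Finset.sum_mul]

theorem l2_fourierInv (f : 𝓢(R3, ℂ)) : l2 (𝓕⁻ f : 𝓢(R3, ℂ)) = l2 f := by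
  have := SchwartzMap.norm_fourier_toL2_eq (𝓕⁻ f : 𝓢(R3, ℂ))
  rw [FourierTransform.fourier_fourierInv_eq, SchwartzMap.norm_toLp, SchwartzMap.norm_toLp] at this
  exact this.symm

/-- Plancherel reduces this to the inequality ⟨ξ, v⟩² ≤ ‖ξ‖² between symbols. -/
theorem l2_lineDeriv_lineDeriv_le (f : 𝓢(R3, ℂ)) {v : R3} (hv : ‖v‖ ≤ 1) :
    l2 (∂_{v} (∂_{v} f : 𝓢(R3, ℂ)) : 𝓢(R3, ℂ)) ≤ l2 (schwartzLaplacian f) := by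
  rw [← l2_fourierInv, ← l2_fourierInv (schwartzLaplacian f)]
  refine ENNReal.toReal_mono
    (eLpNorm_schwartz_ne_top (𝓕⁻ (schwartzLaplacian f) : 𝓢(R3, ℂ))) (eLpNorm_mono fun ξ => ?_)
  rw [fourierInv_lineDeriv_lineDeriv_apply, fourierInv_schwartzLaplacian_apply]
  simp only [norm_mul, norm_neg]
  gcongr
  rw [← Complex.ofReal_pow, Complex.norm_real, Complex.norm_real, norm_pow, norm_pow, norm_norm]
  gcongr
  exact (abs_real_inner_le_norm ξ v).trans (mul_le_of_le_one_right (norm_nonneg _) hv)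

/-- Dimension three enters here: the square decays like `‖x‖⁻⁴`, and 4 > 3. -/
theorem memLp_resolventSymbol : MemLp (fun x : R3 => (1 + ‖x‖ ^ 2)⁻¹) 2 volume := by
  have hc : Continuous (fun x : R3 => (1 + ‖x‖ ^ 2)⁻¹) := by
    apply Continuous.inv₀ (by fun_prop)
    intro x; positivity
  rw [memLp_two_iff_integrable_sq hc.aestronglyMeasurable]
  have := integrable_rpow_neg_one_add_norm_sq (E := R3) (μ := volume) (r := 4) (by simp; norm_num)
  refine this.congr (ae_of_all _ fun x => ?_)
  simp only
  rw [show (-4 / 2 : ℝ) = -(2 : ℕ) by norm_num, Real.rpow_neg (by positivity), Real.rpow_natCast,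
    inv_pow]

/-- Cauchy–Schwarz on `𝓕⁻ f = (1 + ‖ξ‖²)⁻¹ · (1 + ‖ξ‖²) 𝓕⁻ f`, whose second factor is the transform
of `w = f - (2π)⁻² Δf`. -/
theorem exists_norm_le_l2 : ∃ C : ℝ, 0 < C ∧ ∀ (f : 𝓢(R3, ℂ)) (x : R3),
    ‖f x‖ ≤ C * (l2 f + l2 (schwartzLaplacian f)) := by
  refine ⟨l2 (fun x : R3 => (1 + ‖x‖ ^ 2)⁻¹) + 1, by linarith [l2_nonneg (fun x : R3 => (1 + ‖x‖ ^ 2)⁻¹)],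
    fun f x => ?_⟩
  set c : ℝ := ((2 * π) ^ 2)⁻¹
  have hc0 : 0 ≤ c := by positivity
  have hc1 : c ≤ 1 := by
    apply inv_le_one_of_one_le₀
    nlinarith [Real.pi_gt_three]
  let w : 𝓢(R3, ℂ) := f - (c : ℂ) • schwartzLaplacian f
  have hw : ∀ ξ, (𝓕⁻ w : 𝓢(R3, ℂ)) ξ = (1 + ‖ξ‖ ^ 2 : ℝ) * (𝓕⁻ f : 𝓢(R3, ℂ)) ξ := by
    intro ξ
    have h1 : 𝓕⁻ w = 𝓕⁻ f - (c : ℂ) • 𝓕⁻ (schwartzLaplacian f) := by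
      have := (FourierTransform.fourierInvCLM ℂ 𝓢(R3, ℂ)).map_sub f ((c : ℂ) • schwartzLaplacian f)
      rw [map_smul] at this
      exact this
    have hcc : (c : ℂ) * (2 * π) ^ 2 = 1 := by
      have : c * (2 * π) ^ 2 = 1 := inv_mul_cancel₀ (by positivity)
      exact_mod_cast this
    rw [h1, _root_.sub_apply, _root_.smul_apply, fourierInv_schwartzLaplacian_apply, smul_eq_mul]
    push_cast
    linear_combination ((‖ξ‖ : ℂ) ^ 2 * (𝓕⁻ f : 𝓢(R3, ℂ)) ξ) * hcc
  -- `f` is the Fourier transform of `𝓕⁻ f`, so its values are bounded by the L¹ norm of `𝓕⁻ f`.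
  have h1 : ‖f x‖ ≤ (eLpNorm (𝓕⁻ f : 𝓢(R3, ℂ)) 1 volume).toReal := by
    have := SchwartzMap.norm_fourier_apply_le_toLp_one (𝓕⁻ f : 𝓢(R3, ℂ)) x
    rwa [FourierTransform.fourier_fourierInv_eq, SchwartzMap.norm_toLp] at this
  have h2 : eLpNorm (𝓕⁻ f : 𝓢(R3, ℂ)) 1 volume ≤
      eLpNorm (fun x : R3 => (1 + ‖x‖ ^ 2)⁻¹) 2 volume * eLpNorm (𝓕⁻ w : 𝓢(R3, ℂ)) 2 volume := by
    have e : ((𝓕⁻ f : 𝓢(R3, ℂ)) : R3 → ℂ) = (fun x : R3 => (1 + ‖x‖ ^ 2)⁻¹) • ((𝓕⁻ w : 𝓢(R3, ℂ)) : R3 → ℂ) := by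
      ext ξ
      have : (1 + ‖ξ‖ ^ 2) ≠ 0 := by positivity
      simp only [Pi.smul_apply', Complex.real_smul, hw]
      rw [← mul_assoc, ← Complex.ofReal_mul, inv_mul_cancel₀ this]; simp
    rw [e]
    exact eLpNorm_smul_le_mul_eLpNorm (SchwartzMap.continuous _).aestronglyMeasurable
      memLp_resolventSymbol.1
  have h3 : (eLpNorm (𝓕⁻ f : 𝓢(R3, ℂ)) 1 volume).toReal ≤ l2 (fun x : R3 => (1 + ‖x‖ ^ 2)⁻¹) * l2 w := by
    rw [← l2_fourierInv w, l2, l2, ← ENNReal.toReal_mul]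
    exact ENNReal.toReal_mono (ENNReal.mul_ne_top memLp_resolventSymbol.2.ne
      (eLpNorm_schwartz_ne_top (𝓕⁻ w : 𝓢(R3, ℂ)))) h2
  have h4 : l2 w ≤ l2 f + l2 (schwartzLaplacian f) := by
    have e : (w : R3 → ℂ) = (f : R3 → ℂ) - (c : ℂ) • (schwartzLaplacian f : R3 → ℂ) := by
      ext x; simp [w]
    have t1 := eLpNorm_sub_le (μ := volume) (f := f) (g := (c : ℂ) • (schwartzLaplacian f : R3 → ℂ))
      (p := 2) f.continuous.aestronglyMeasurable
      ((schwartzLaplacian f).continuous.aestronglyMeasurable.const_smul _) (by norm_num)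
    have t2 : eLpNorm ((c : ℂ) • (schwartzLaplacian f : R3 → ℂ)) 2 volume
        ≤ eLpNorm (schwartzLaplacian f) 2 volume := by
      refine eLpNorm_mono fun x => ?_
      simp only [Pi.smul_apply, norm_smul, Complex.norm_real, Real.norm_of_nonneg hc0]
      exact mul_le_of_le_one_left (norm_nonneg _) hc1
    rw [l2, l2, l2, ← ENNReal.toReal_add (eLpNorm_schwartz_ne_top f) (eLpNorm_schwartz_ne_top (schwartzLaplacian f)), e]
    refine ENNReal.toReal_mono (ENNReal.add_ne_top.mpr ⟨(eLpNorm_schwartz_ne_top f), (eLpNorm_schwartz_ne_top (schwartzLaplacian f))⟩) ?_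
    exact t1.trans (by gcongr)
  calc ‖f x‖ ≤ _ := h1
    _ ≤ _ := h3
    _ ≤ _ := by
      have := l2_nonneg (fun x : R3 => (1 + ‖x‖ ^ 2)⁻¹)
      have h5 := l2_nonneg f
      have h6 := l2_nonneg (schwartzLaplacian f)
      nlinarith

/-- With `u = ∂_v f`, integration by parts gives ∫|u|⁴ = -∫ f ∂_v(ū²u) ≤ 3S ∫|u|²|∂_v u| ≤ 3S
(∫|u|⁴)^(1/2) ‖∂_v u‖₂, and a factor (∫|u|⁴)^(1/2) cancels. -/
theorem integral_norm_pow_four_le (f : 𝓢(R3, ℂ)) (v : R3) {S : ℝ} (hS : ∀ x, ‖f x‖ ≤ S) :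
    ∫ x, ‖(∂_{v} f : 𝓢(R3, ℂ)) x‖ ^ 4 ≤ (3 * S * l2 (∂_{v} (∂_{v} f : 𝓢(R3, ℂ)) : 𝓢(R3, ℂ))) ^ 2 := by
  set u : 𝓢(R3, ℂ) := ∂_{v} f
  set u' : 𝓢(R3, ℂ) := ∂_{v} u
  have hS0 : 0 ≤ S := (norm_nonneg _).trans (hS 0)
  -- `M` only serves the integrability needed to integrate by parts; it does not enter the estimate.
  obtain ⟨M, hM⟩ : ∃ M, ∀ x, ‖u x‖ ≤ M := ⟨_, SchwartzMap.norm_le_seminorm ℝ u⟩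
  let g : R3 → ℂ := fun x => conj (u x) ^ 2 * u x
  let g' : R3 → ℂ := fun x => 2 * conj (u x) * conj (u' x) * u x + conj (u x) ^ 2 * u' x
  have hgd : ∀ x, HasLineDerivAt ℝ g (g' x) x v := by
    intro x
    have h1 : HasLineDerivAt ℝ u (u' x) x v := by
      have := (u.hasFDerivAt x).hasLineDerivAt v
      rwa [← SchwartzMap.lineDerivOp_apply_eq_fderiv] at this
    have h2 : HasDerivAt (fun t : ℝ => u (x + t • v)) (u' x) 0 := h1
    have h3 : HasDerivAt (fun t : ℝ => conj (u (x + t • v))) (conj (u' x)) 0 :=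
      Complex.conjCLE.toContinuousLinearMap.hasFDerivAt.comp_hasDerivAt 0 h2
    have h4 := (h3.pow 2).mul h2
    refine h4.congr_deriv ?_
    simp [g']
  have huc := u.continuous
  have hu'c := u'.continuous
  have hgc : Continuous g := by fun_prop
  have hg'c : Continuous g' := by fun_prop
  have hn : ∀ x, ‖g x‖ = ‖u x‖ ^ 3 := fun x => by simp [g]; ring
  have hn' : ∀ x, ‖g' x‖ ≤ 3 * (‖u x‖ ^ 2 * ‖u' x‖) := fun x => by
    refine (norm_add_le _ _).trans (le_of_eq ?_)
    simp only [norm_mul, norm_pow, RCLike.norm_conj, Complex.norm_ofNat]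
    ring
  have hgb : ∀ x, ‖g x‖ ≤ M ^ 3 := fun x => by
    rw [hn]; exact pow_le_pow_left₀ (norm_nonneg _) (hM x) 3
  have hg'b : ∀ x, ‖g' x‖ ≤ 3 * M ^ 2 * ‖u' x‖ := fun x => by
    refine (hn' x).trans ?_
    have := pow_le_pow_left₀ (norm_nonneg _) (hM x) 2
    nlinarith [norm_nonneg (u' x), mul_le_mul_of_nonneg_right this (norm_nonneg (u' x))]
  have hg'I : Integrable g' := Integrable.mono' (u'.integrable.norm.const_mul (3 * M ^ 2))
    hg'c.aestronglyMeasurable (ae_of_all _ hg'b)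
  have hI := integral_bilinear_hasLineDerivAt_right_eq_neg_left_of_integrable (μ := volume)
    (f := f) (f' := u) (g := g) (g' := g') (v := v) (B := ContinuousLinearMap.mul ℝ ℂ)
    (u.integrable.mul_bdd (c := M ^ 3) hgc.aestronglyMeasurable (ae_of_all _ hgb))
    (hg'I.bdd_mul (c := S) f.continuous.aestronglyMeasurable (ae_of_all _ hS))
    (f.integrable.mul_bdd (c := M ^ 3) hgc.aestronglyMeasurable (ae_of_all _ hgb))
    (fun x _ => by
      have := (f.hasFDerivAt x).hasLineDerivAt v
      rwa [← SchwartzMap.lineDerivOp_apply_eq_fderiv] at this) (fun x _ => hgd x)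
  simp only [ContinuousLinearMap.mul_apply'] at hI
  set X := ∫ x, ‖u x‖ ^ 4
  have hX0 : 0 ≤ X := integral_nonneg fun x => by positivity
  have hX : (X : ℂ) = ∫ x, u x * g x := by
    rw [← integral_complex_ofReal]
    congr 1; ext x
    have : u x * g x = (u x * conj (u x)) ^ 2 := by simp only [g]; ring
    rw [this, Complex.mul_conj, Complex.normSq_eq_norm_sq]
    push_cast; ring
  have hu2 : MemLp (fun x => ‖u x‖ ^ 2) 2 := by
    have h1 : MemLp (fun x => ‖u x‖) 2 := (u.memLp 2 volume).norm
    have h2 : MemLp (fun x => ‖u x‖) ⊤ := (u.memLp ⊤ volume).norm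
    have := h1.mul (r := 2) h2
    refine this.ae_eq (ae_of_all _ fun x => ?_)
    simp [sq]
  have hu'2 : MemLp (fun x => ‖u' x‖) 2 := (u'.memLp 2 volume).norm
  have hXle : X ≤ 3 * S * (√X * l2 u') := by
    calc X = ‖(X : ℂ)‖ := by rw [Complex.norm_real, Real.norm_of_nonneg hX0]
      _ = ‖∫ x, f x * g' x‖ := by rw [hX, hI, norm_neg]
      _ ≤ ∫ x, 3 * S * (‖u x‖ ^ 2 * ‖u' x‖) := by
        refine norm_integral_le_of_norm_le ((hu2.integrable_mul hu'2).const_mul (3 * S))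
          (ae_of_all _ fun x => ?_)
        rw [norm_mul]
        calc ‖f x‖ * ‖g' x‖ ≤ S * (3 * (‖u x‖ ^ 2 * ‖u' x‖)) :=
              mul_le_mul (hS x) (hn' x) (norm_nonneg _) hS0
          _ = _ := by ring
      _ = 3 * S * ∫ x, ‖u x‖ ^ 2 * ‖u' x‖ := integral_const_mul _ _
      _ ≤ 3 * S * (√X * l2 u') := by
        refine mul_le_mul_of_nonneg_left ?_ (by positivity)
        have := integral_mul_le_Lp_mul_Lq_of_nonneg (μ := volume) Real.HolderConjugate.two_two
          (ae_of_all _ fun x => by positivity : 0 ≤ᵐ[volume] fun x => ‖u x‖ ^ 2)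
          (ae_of_all _ fun x => norm_nonneg _ : 0 ≤ᵐ[volume] fun x => ‖u' x‖)
          (by simpa using hu2) (by simpa using hu'2)
        refine this.trans (le_of_eq ?_)
        rw [Real.sqrt_eq_rpow]
        congr 1
        · congr 2; ext x; rw [Real.rpow_ofNat, ← pow_mul]
        · simp only [Real.rpow_ofNat]
          rw [← l2_sq (u'.memLp 2 volume), ← Real.sqrt_eq_rpow, Real.sqrt_sq (l2_nonneg _)]
  have hs := Real.sq_sqrt hX0
  have hsX : √X ≤ 3 * S * l2 u' := by
    rcases (Real.sqrt_nonneg X).eq_or_lt with h0 | h0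
    · rw [← h0]; have := l2_nonneg u'; positivity
    · refine le_of_mul_le_mul_right ?_ h0
      nlinarith
  calc X = √X ^ 2 := hs.symm
    _ ≤ _ := pow_le_pow_left₀ (Real.sqrt_nonneg _) hsX 2

end

/-! ### Passage of the estimates to H², and identification of the weak Laplacian. -/

section
open Filter Topology
open scoped SchwartzMap LineDeriv Real

theorem eLpNorm_four_lineDeriv_le (f : 𝓢(R3, ℂ)) (v : R3) {S : ℝ} (hS : ∀ x, ‖f x‖ ≤ S) :
    eLpNorm (∂_{v} f : 𝓢(R3, ℂ)) 4 volume
      ≤ ENNReal.ofReal (√(3 * S * l2 (∂_{v} (∂_{v} f : 𝓢(R3, ℂ)) : 𝓢(R3, ℂ)))) := by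
  have h := integral_norm_pow_four_le f v hS
  have hS0 : 0 ≤ S := (norm_nonneg _).trans (hS 0)
  set A := 3 * S * l2 (∂_{v} (∂_{v} f : 𝓢(R3, ℂ)) : 𝓢(R3, ℂ))
  have hA : 0 ≤ A := mul_nonneg (by positivity) (l2_nonneg _)
  rw [((∂_{v} f : 𝓢(R3, ℂ)).memLp 4 volume).eLpNorm_eq_integral_rpow_norm (by norm_num)
    (by norm_num)]
  apply ENNReal.ofReal_le_ofReal
  simp only [ENNReal.toReal_ofNat, Real.rpow_ofNat]
  refine (Real.rpow_le_rpow (integral_nonneg fun x => by positivity) h (by norm_num)).trans ?_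
  rw [← Real.rpow_natCast, ← Real.rpow_mul hA, Real.sqrt_eq_rpow]
  norm_num

/-- `f ∈ H²(ℝ³; ℂ)` with weak gradient `g` and weak Hessian `h`. -/
structure HasH2Derivs (f : R3 → ℂ) (g : Fin 3 → R3 → ℂ) (h : Fin 3 → Fin 3 → R3 → ℂ) : Prop where
  memLp : MemLp f 2
  grad : ∀ i, MemLp (g i) 2 ∧ IsWeakPartial i f (g i)
  hess : ∀ i j, MemLp (h i j) 2 ∧ IsWeakPartial j (g i) (h i j)

theorem memH2_iff {f : R3 → ℂ} : MemH2 f ↔ ∃ g h, HasH2Derivs f g h :=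
  ⟨fun ⟨hf, g, h, hg, hh⟩ => ⟨g, h, hf, hg, hh⟩, fun ⟨g, h, H⟩ => ⟨H.memLp, g, h, H.grad, H.hess⟩⟩

theorem tendsto_l2_of_eLpNorm_sub {G : Type*} [NormedAddCommGroup G] {F : ℕ → R3 → G} {f : R3 → G}
    (hF : ∀ n, MemLp (F n) 2) (hf : MemLp f 2)
    (h : Tendsto (fun n => eLpNorm (fun x => F n x - f x) 2 volume) atTop (𝓝 0)) :
    Tendsto (fun n => l2 (F n)) atTop (𝓝 (l2 f)) := by
  have : Tendsto (fun n => (hF n).toLp (F n)) atTop (𝓝 (hf.toLp f)) := by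
    rw [Lp.tendsto_Lp_iff_tendsto_eLpNorm'']
    exact h
  simpa [Lp.norm_toLp, l2] using this.norm

theorem exists_subseq_tendsto_ae {G : Type*} [NormedAddCommGroup G] {F : ℕ → R3 → G} {f : R3 → G}
    (hF : ∀ n, MemLp (F n) 2) (hf : MemLp f 2)
    (h : Tendsto (fun n => eLpNorm (fun x => F n x - f x) 2 volume) atTop (𝓝 0)) :
    ∃ ns : ℕ → ℕ, StrictMono ns ∧ ∀ᵐ x, Tendsto (fun i => F (ns i) x) atTop (𝓝 (f x)) :=
  (tendstoInMeasure_of_tendsto_eLpNorm (p := 2) (by norm_num) (fun n => (hF n).1) hf.1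
    h).exists_seq_tendsto_ae

/-- Lower semicontinuity of the `L^p` norm under L² convergence: Fatou along an almost everywhere
convergent subsequence. -/
theorem eLpNorm_le_of_tendsto_l2 {G : Type*} [NormedAddCommGroup G] {F : ℕ → R3 → G} {f : R3 → G}
    (hF : ∀ n, MemLp (F n) 2) (hf : MemLp f 2)
    (h : Tendsto (fun n => eLpNorm (fun x => F n x - f x) 2 volume) atTop (𝓝 0))
    {p : ℝ≥0∞} {c : ℕ → ℝ} {b : ℝ} (hc : Tendsto c atTop (𝓝 b))
    (hb : ∀ n, eLpNorm (F n) p volume ≤ ENNReal.ofReal (c n)) :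
    eLpNorm f p volume ≤ ENNReal.ofReal b := by
  obtain ⟨ns, hns, hae⟩ := exists_subseq_tendsto_ae hF hf h
  refine (Lp.eLpNorm_lim_le_liminf_eLpNorm (fun n => (hF (ns n)).1) f hae).trans ?_
  have ht : Tendsto (fun n => ENNReal.ofReal (c (ns n))) atTop (𝓝 (ENNReal.ofReal b)) :=
    (ENNReal.continuous_ofReal.tendsto b).comp (hc.comp hns.tendsto_atTop)
  rw [← ht.liminf_eq]
  exact liminf_le_liminf (Eventually.of_forall fun n => hb _)

theorem add_le_two_mul_sqrt (a b : ℝ) : a + b ≤ 2 * √(a ^ 2 + b ^ 2) := by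
  have h1 : a ≤ √(a ^ 2 + b ^ 2) := Real.le_sqrt_of_sq_le (by nlinarith)
  have h2 : b ≤ √(a ^ 2 + b ^ 2) := Real.le_sqrt_of_sq_le (by nlinarith)
  linarith

theorem exists_schwartz_h2_bounds : ∃ C : ℝ, 0 < C ∧ ∀ f : 𝓢(R3, ℂ),
    (∀ x, ‖f x‖ ≤ C * √(l2 f ^ 2 + l2 (schwartzLaplacian f) ^ 2)) ∧
    ∀ i, eLpNorm (∂_{basisVec i} f : 𝓢(R3, ℂ)) 4 volume
      ≤ ENNReal.ofReal (C * √(l2 f ^ 2 + l2 (schwartzLaplacian f) ^ 2)) := by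
  obtain ⟨C, hC, h⟩ := exists_norm_le_l2
  -- `2 * C` serves the sup bound, since `a + b ≤ 2 * N`. Inserting `S = 2 * C * N` into the L⁴
  -- estimate gives `√(6 * C * N ^ 2)`, hence the second summand.
  refine ⟨2 * C + √(6 * C), by positivity, fun f => ?_⟩
  have ha := l2_nonneg f
  have hb := l2_nonneg (schwartzLaplacian f)
  set a := l2 f
  set b := l2 (schwartzLaplacian f)
  set N := √(a ^ 2 + b ^ 2)
  have hN : 0 ≤ N := Real.sqrt_nonneg _
  have hab : a + b ≤ 2 * N := add_le_two_mul_sqrt a b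
  have hbN : b ≤ N := Real.le_sqrt_of_sq_le (by nlinarith)
  have h1 : ∀ x, ‖f x‖ ≤ 2 * C * N := fun x => (h f x).trans (by nlinarith)
  have hs := Real.sqrt_nonneg (6 * C)
  refine ⟨fun x => (h1 x).trans (by nlinarith), fun i => ?_⟩
  refine (eLpNorm_four_lineDeriv_le f (basisVec i) h1).trans (ENNReal.ofReal_le_ofReal ?_)
  have h2 := l2_lineDeriv_lineDeriv_le f (v := basisVec i) (by simp [basisVec])
  have h3 : 3 * (2 * C * N) * l2 (∂_{basisVec i} (∂_{basisVec i} f : 𝓢(R3, ℂ)) : 𝓢(R3, ℂ))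
      ≤ (6 * C) * N ^ 2 := by
    have := mul_le_mul_of_nonneg_left (h2.trans hbN) (by positivity : 0 ≤ 6 * C * N)
    nlinarith
  refine (Real.sqrt_le_sqrt h3).trans ?_
  rw [Real.sqrt_mul (by positivity), Real.sqrt_sq hN]
  nlinarith

/-- The right-hand sides involve only `f` and its Laplacian, both of which converge in L² along the
approximation, so the Schwartz bounds survive in the limit. The sup bound is the case `p = ⊤`. -/
theorem exists_h2_bounds : ∃ C : ℝ, 0 < C ∧ ∀ f g h, HasH2Derivs f g h →
    (∀ᵐ x, ‖f x‖ ≤ C * √(l2 f ^ 2 + l2 (fun x => ∑ i, h i i x) ^ 2)) ∧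
    ∀ i, eLpNorm (g i) 4 volume
      ≤ ENNReal.ofReal (C * √(l2 f ^ 2 + l2 (fun x => ∑ i, h i i x) ^ 2)) := by
  obtain ⟨C, hC, hS⟩ := exists_schwartz_h2_bounds
  refine ⟨C, hC, fun f g h H => ?_⟩
  obtain ⟨F, hF, hG, hH⟩ := exists_schwartz_approx H.memLp H.grad H.hess
  have hL : MemLp (fun x => ∑ i, h i i x) 2 volume := memLp_finsetSum _ fun i _ => (H.hess i i).1
  have tL : Tendsto (fun n => eLpNorm (fun x => schwartzLaplacian (F n) x - ∑ i, h i i x) 2 volume)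
      atTop (𝓝 0) := by
    have ts : Tendsto (fun n => ∑ i, eLpNorm (fun x =>
        (∂_{basisVec i} (∂_{basisVec i} (F n) : 𝓢(R3, ℂ)) : 𝓢(R3, ℂ)) x - h i i x) 2 volume)
        atTop (𝓝 0) := by
      simpa using tendsto_finsetSum Finset.univ fun i _ => hH i i
    refine tendsto_of_tendsto_of_tendsto_of_le_of_le tendsto_const_nhds ts (fun n => zero_le)
      fun n => ?_
    have e : (fun x => schwartzLaplacian (F n) x - ∑ i, h i i x) = ∑ i, fun x =>
        (∂_{basisVec i} (∂_{basisVec i} (F n) : 𝓢(R3, ℂ)) : 𝓢(R3, ℂ)) x - h i i x := by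
      ext x
      simp [schwartzLaplacian, Finset.sum_apply, Finset.sum_sub_distrib]
    rw [e]
    exact eLpNorm_sum_le (fun i _ => (SchwartzMap.continuous _).aestronglyMeasurable.sub
      (H.hess i i).1.1) (by norm_num)
  have t1 := tendsto_l2_of_eLpNorm_sub (fun n => (F n).memLp 2 volume) H.memLp hF
  have t2 := tendsto_l2_of_eLpNorm_sub (fun n => (schwartzLaplacian (F n)).memLp 2 volume) hL tL
  have tN : Tendsto (fun n => C * √(l2 (F n) ^ 2 + l2 (schwartzLaplacian (F n)) ^ 2)) atTop
      (𝓝 (C * √(l2 f ^ 2 + l2 (fun x => ∑ i, h i i x) ^ 2))) :=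
    (((t1.pow 2).add (t2.pow 2)).sqrt).const_mul C
  refine ⟨?_, fun i => ?_⟩
  · have hb := eLpNorm_le_of_tendsto_l2 (p := ⊤) (fun n => (F n).memLp 2 volume) H.memLp hF tN
      fun n => by
        rw [eLpNorm_exponent_top]
        exact eLpNormEssSup_le_of_ae_bound (ae_of_all _ (hS (F n)).1)
    rw [eLpNorm_exponent_top] at hb
    filter_upwards [ae_le_eLpNormEssSup (f := f) (μ := volume)] with x hx
    have := hx.trans hb
    rwa [← ofReal_norm, ENNReal.ofReal_le_ofReal_iff (by positivity)] at this
  · exact eLpNorm_le_of_tendsto_l2 (fun n => (∂_{basisVec i} (F n) : 𝓢(R3, ℂ)).memLp 2 volume)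
      (H.grad i).1 (hG i) tN fun n => (hS (F n)).2 i

theorem IsTestFunction.laplacian_eq {φ : R3 → ℝ} (hφ : IsTestFunction φ) (x : R3) :
    Laplacian.laplacian φ x
      = ∑ i, fderiv ℝ (fun y => fderiv ℝ φ y (basisVec i)) x (basisVec i) := by
  rw [InnerProductSpace.laplacian_eq_iteratedFDeriv_orthonormalBasis φ
    (EuclideanSpace.basisFun (Fin 3) ℝ)]
  refine Finset.sum_congr rfl fun i _ => ?_
  have hd : DifferentiableAt ℝ (fderiv ℝ φ) x :=
    (hφ.1.fderiv_right (m := 1) (by norm_cast)).differentiable (by norm_num) x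
  rw [iteratedFDeriv_two_apply, fderiv_clm_apply hd (differentiableAt_const _)]
  simp

theorem HasH2Derivs.isWeakLaplacian {f : R3 → ℂ} {g : Fin 3 → R3 → ℂ}
    {h : Fin 3 → Fin 3 → R3 → ℂ} (H : HasH2Derivs f g h) :
    IsWeakLaplacian f (fun x => ∑ i, h i i x) := by
  have hL : MemLp (fun x => ∑ i, h i i x) 2 volume := memLp_finsetSum _ fun i _ => (H.hess i i).1
  refine ⟨H.memLp.locallyIntegrable (by norm_num), hL.locallyIntegrable (by norm_num),
    fun φ hφ => ?_⟩
  have hφi := fun i => hφ.fderiv_apply (basisVec i)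
  have hφii := fun i => (hφi i).fderiv_apply (basisVec i)
  simp only [hφ.laplacian_eq, Finset.sum_smul, Finset.smul_sum]
  rw [integral_finsetSum _ fun i _ =>
      integrable_smul_of_memLp_two (hφii i).1.continuous (hφii i).2 H.memLp,
    integral_finsetSum _ fun i _ =>
      integrable_smul_of_memLp_two hφ.1.continuous hφ.2 (H.hess i i).1]
  refine Finset.sum_congr rfl fun i _ => ?_
  rw [(H.grad i).2.2.2 _ (hφi i), (H.hess i i).2.2.2 _ hφ, neg_neg]

theorem IsWeakLaplacian.ae_eq {f g g' : R3 → ℂ} (h : IsWeakLaplacian f g)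
    (h' : IsWeakLaplacian f g') : g =ᵐ[volume] g' :=
  ae_eq_of_integral_contDiff_smul_eq h.2.1 h'.2.1 fun φ hφ hc => by
    rw [← h.2.2 φ ⟨hφ, hc⟩, ← h'.2.2 φ ⟨hφ, hc⟩]

/-- The choice made in `weakLaplacian` is harmless: weak Laplacians are unique almost everywhere, so
the trace of any weak Hessian may replace it. -/
theorem HasH2Derivs.weakLaplacian_ae_eq {f : R3 → ℂ} {g : Fin 3 → R3 → ℂ}
    {h : Fin 3 → Fin 3 → R3 → ℂ} (H : HasH2Derivs f g h) :
    weakLaplacian f =ᵐ[volume] fun x => ∑ i, h i i x := by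
  have hex : ∃ g, IsWeakLaplacian f g := ⟨_, H.isWeakLaplacian⟩
  rw [weakLaplacian, dif_pos hex]
  exact hex.choose_spec.ae_eq H.isWeakLaplacian

theorem HasH2Derivs.normH2_eq {f : R3 → ℂ} {g : Fin 3 → R3 → ℂ}
    {h : Fin 3 → Fin 3 → R3 → ℂ} (H : HasH2Derivs f g h) :
    normH2 f = √(l2 f ^ 2 + l2 (fun x => ∑ i, h i i x) ^ 2) := by
  rw [normH2, eLpNorm_congr_ae H.weakLaplacian_ae_eq]; rfl

theorem IsWeakPartial.sub {i : Fin 3} {f f' g g' : R3 → ℂ} (h : IsWeakPartial i f g)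
    (h' : IsWeakPartial i f' g') : IsWeakPartial i (fun x => f x - f' x) (fun x => g x - g' x) := by
  refine ⟨h.1.sub h'.1, h.2.1.sub h'.2.1, fun φ hφ => ?_⟩
  have hi : ∀ {ψ : R3 → ℝ} {u : R3 → ℂ}, IsTestFunction ψ → LocallyIntegrable u →
      Integrable (fun x => ψ x • u x) := fun hψ hu =>
    hu.integrable_smul_left_of_hasCompactSupport hψ.1.continuous hψ.2
  have hφi := hφ.fderiv_apply (basisVec i)
  simp only [smul_sub]
  rw [integral_sub (hi hφi h.1) (hi hφi h'.1), integral_sub (hi hφ h.2.1) (hi hφ h'.2.1),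
    h.2.2 φ hφ, h'.2.2 φ hφ]
  ring

theorem HasH2Derivs.sub {f f' : R3 → ℂ} {g g' : Fin 3 → R3 → ℂ}
    {h h' : Fin 3 → Fin 3 → R3 → ℂ} (H : HasH2Derivs f g h) (H' : HasH2Derivs f' g' h') :
    HasH2Derivs (fun x => f x - f' x) (fun i x => g i x - g' i x)
      (fun i j x => h i j x - h' i j x) :=
  ⟨H.memLp.sub H'.memLp, fun i => ⟨(H.grad i).1.sub (H'.grad i).1, (H.grad i).2.sub (H'.grad i).2⟩,
    fun i j => ⟨(H.hess i j).1.sub (H'.hess i j).1, (H.hess i j).2.sub (H'.hess i j).2⟩⟩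

end

/-! ### The weak product rule by approximation. -/

section
open Filter Topology
open scoped SchwartzMap LineDeriv Real

theorem integral_norm_mul_norm_le {X Y : Type*} [NormedAddCommGroup X] [NormedAddCommGroup Y]
    {u : R3 → X} {v : R3 → Y} (hu : MemLp u 2) (hv : MemLp v 2) :
    ∫ x, ‖u x‖ * ‖v x‖ ≤ l2 u * l2 v := by
  have := integral_mul_le_Lp_mul_Lq_of_nonneg (μ := volume) Real.HolderConjugate.two_two
    (ae_of_all _ fun x => norm_nonneg _ : 0 ≤ᵐ[volume] fun x => ‖u x‖)
    (ae_of_all _ fun x => norm_nonneg _ : 0 ≤ᵐ[volume] fun x => ‖v x‖)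
    (by simpa using hu.norm) (by simpa using hv.norm)
  simp only [Real.rpow_ofNat] at this
  rwa [← l2_sq hu, ← l2_sq hv, ← Real.sqrt_eq_rpow, ← Real.sqrt_eq_rpow,
    Real.sqrt_sq (l2_nonneg _), Real.sqrt_sq (l2_nonneg _)] at this

section Bilinear
variable {X Y Z W : Type*} [NormedAddCommGroup X] [NormedSpace ℝ X] [NormedAddCommGroup Y]
  [NormedSpace ℝ Y] [NormedAddCommGroup Z] [NormedSpace ℝ Z] [NormedAddCommGroup W]
  [NormedSpace ℝ W] (B : W →L[ℝ] Y →L[ℝ] Z)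

theorem aestronglyMeasurable_bilinear {K : R3 → X →L[ℝ] W} {v : R3 → X} {u : R3 → Y}
    (hK : AEStronglyMeasurable K) (hv : AEStronglyMeasurable v) (hu : AEStronglyMeasurable u) :
    AEStronglyMeasurable (fun x => B (K x (v x)) (u x)) volume := by
  have h1 : AEStronglyMeasurable (fun x => K x (v x)) volume :=
    isBoundedBilinearMap_apply.continuous.comp_aestronglyMeasurable (hK.prodMk hv)
  exact B.aestronglyMeasurable_comp₂ h1 hu

theorem norm_bilinear_le {K : X →L[ℝ] W} {M : ℝ} (hK : ‖K‖ ≤ M) (v : X) (u : Y) :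
    ‖B (K v) u‖ ≤ ‖B‖ * M * (‖v‖ * ‖u‖) := by
  calc ‖B (K v) u‖ ≤ ‖B‖ * ‖K v‖ * ‖u‖ := B.le_opNorm₂ _ _
    _ ≤ ‖B‖ * (M * ‖v‖) * ‖u‖ := by gcongr; exact K.le_of_opNorm_le hK v
    _ = _ := by ring

theorem integrable_bilinear {K : R3 → X →L[ℝ] W} {v : R3 → X} {u : R3 → Y} {M : ℝ}
    (hK : AEStronglyMeasurable K) (hM : ∀ᵐ x, ‖K x‖ ≤ M) (hv : MemLp v 2) (hu : MemLp u 2) :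
    Integrable (fun x => B (K x (v x)) (u x)) := by
  refine Integrable.mono' ((hv.norm.integrable_mul hu.norm).const_mul (‖B‖ * M))
    (aestronglyMeasurable_bilinear B hK hv.1 hu.1) ?_
  filter_upwards [hM] with x hx
  exact norm_bilinear_le B hx _ _

theorem integrable_bilinear_of_tendsto {K : ℕ → R3 → X →L[ℝ] W}
    {K₀ : R3 → X →L[ℝ] W} {v : R3 → X} {u : R3 → Y} {M : ℝ}
    (hK : ∀ n, AEStronglyMeasurable (K n)) (hM : ∀ n, ∀ᵐ x, ‖K n x‖ ≤ M)
    (hK₀ : ∀ᵐ x, Tendsto (fun n => K n x) atTop (𝓝 (K₀ x))) (hv : MemLp v 2) (hu : MemLp u 2) :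
    Integrable (fun x => B (K₀ x (v x)) (u x)) := by
  refine integrable_bilinear B (M := M) (aestronglyMeasurable_of_tendsto_ae atTop hK hK₀) ?_ hv hu
  filter_upwards [hK₀, ae_all_iff.mpr hM] with x h1 h2
  exact le_of_tendsto h1.norm (Eventually.of_forall h2)

/-- Dominated convergence treats the coefficients `K n` with `v₀` and `u₀` fixed. Replacing `v n`,
`u n` by their limits costs only L² distances, thanks to the uniform bound `M`. -/
theorem tendsto_integral_bilinear {K : ℕ → R3 → X →L[ℝ] W} {K₀ : R3 → X →L[ℝ] W}
    {v : ℕ → R3 → X} {v₀ : R3 → X} {u : ℕ → R3 → Y} {u₀ : R3 → Y} {M : ℝ}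
    (hK : ∀ n, AEStronglyMeasurable (K n)) (hM : ∀ n, ∀ᵐ x, ‖K n x‖ ≤ M)
    (hK₀ : ∀ᵐ x, Tendsto (fun n => K n x) atTop (𝓝 (K₀ x)))
    (hv : ∀ n, MemLp (v n) 2) (hv₀ : MemLp v₀ 2)
    (tv : Tendsto (fun n => l2 (fun x => v n x - v₀ x)) atTop (𝓝 0))
    (hu : ∀ n, MemLp (u n) 2) (hu₀ : MemLp u₀ 2)
    (tu : Tendsto (fun n => l2 (fun x => u n x - u₀ x)) atTop (𝓝 0)) :
    Tendsto (fun n => ∫ x, B (K n x (v n x)) (u n x)) atTop (𝓝 (∫ x, B (K₀ x (v₀ x)) (u₀ x))) := by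
  have T1 : Tendsto (fun n => ∫ x, B (K n x (v₀ x)) (u₀ x)) atTop (𝓝 (∫ x, B (K₀ x (v₀ x)) (u₀ x))) := by
    refine tendsto_integral_of_dominated_convergence (fun x => ‖B‖ * M * (‖v₀ x‖ * ‖u₀ x‖))
      (fun n => aestronglyMeasurable_bilinear B (hK n) hv₀.1 hu₀.1)
      ((hv₀.norm.integrable_mul hu₀.norm).const_mul (‖B‖ * M)) (fun n => ?_) ?_
    · filter_upwards [hM n] with x hx
      exact norm_bilinear_le B hx _ _
    · filter_upwards [hK₀] with x hx
      exact ((B.flip (u₀ x)).continuous.tendsto _).comp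
        (((ContinuousLinearMap.apply ℝ W (v₀ x)).continuous.tendsto _).comp hx)
  have hM0 : 0 ≤ M := by
    obtain ⟨x, hx⟩ := (hM 0).exists
    exact (norm_nonneg (K 0 x)).trans hx
  have T2 : Tendsto (fun n => (∫ x, B (K n x (v n x)) (u n x)) - ∫ x, B (K n x (v₀ x)) (u₀ x)) atTop (𝓝 0) := by
    have hb : ∀ n, ‖(∫ x, B (K n x (v n x)) (u n x)) - ∫ x, B (K n x (v₀ x)) (u₀ x)‖ ≤
        ‖B‖ * M * (l2 (fun x => v n x - v₀ x) * (l2 (fun x => u n x - u₀ x) + l2 u₀)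
          + l2 v₀ * l2 (fun x => u n x - u₀ x)) := by
      intro n
      have mv := (hv n).sub hv₀
      have mu := (hu n).sub hu₀
      rw [← integral_sub (integrable_bilinear B (hK n) (hM n) (hv n) (hu n))
        (integrable_bilinear B (hK n) (hM n) hv₀ hu₀)]
      have I1 := mv.norm.integrable_mul mu.norm
      have I2 := mv.norm.integrable_mul hu₀.norm
      have I3 := hv₀.norm.integrable_mul mu.norm
      calc _ ≤ ∫ x, ‖B‖ * M * ((‖v n x - v₀ x‖ * ‖u n x - u₀ x‖ + ‖v n x - v₀ x‖ * ‖u₀ x‖)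
              + ‖v₀ x‖ * ‖u n x - u₀ x‖) := by
            refine norm_integral_le_of_norm_le (((I1.add I2).add I3).const_mul (‖B‖ * M)) ?_
            filter_upwards [hM n] with x hx
            have e : B (K n x (v n x)) (u n x) - B (K n x (v₀ x)) (u₀ x)
                = (B (K n x (v n x - v₀ x)) (u n x - u₀ x) + B (K n x (v n x - v₀ x)) (u₀ x))
                  + B (K n x (v₀ x)) (u n x - u₀ x) := by
              simp only [map_sub, _root_.sub_apply]; abel
            rw [e, mul_add, mul_add]
            exact norm_add₃_le.trans (add_le_add_three (norm_bilinear_le B hx _ _)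
              (norm_bilinear_le B hx _ _) (norm_bilinear_le B hx _ _))
        _ ≤ _ := by
            have e : ∫ x, ((‖v n x - v₀ x‖ * ‖u n x - u₀ x‖ + ‖v n x - v₀ x‖ * ‖u₀ x‖)
                + ‖v₀ x‖ * ‖u n x - u₀ x‖) = (∫ x, ‖v n x - v₀ x‖ * ‖u n x - u₀ x‖)
                + (∫ x, ‖v n x - v₀ x‖ * ‖u₀ x‖) + ∫ x, ‖v₀ x‖ * ‖u n x - u₀ x‖ :=
              (integral_add (I1.add I2) I3).trans (congrArg (· + _) (integral_add I1 I2))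
            rw [integral_const_mul, e, mul_add (l2 _)]
            exact mul_le_mul_of_nonneg_left (add_le_add_three (integral_norm_mul_norm_le mv mu)
              (integral_norm_mul_norm_le mv hu₀) (integral_norm_mul_norm_le hv₀ mu)) (by positivity)
    refine squeeze_zero_norm hb ?_
    have := ((tv.mul (tu.add_const (l2 u₀))).add (tu.const_mul (l2 v₀))).const_mul (‖B‖ * M)
    simpa using this
  simpa using T2.add T1

end Bilinear

/-- The weak product rule for `A(ψ) u`, with `A` of class `C¹`, obtained from smooth approximations
of `ψ` and `u`. -/
theorem integral_weak_product_rule {V Y Z W : Type*} [NormedAddCommGroup V] [NormedSpace ℝ V]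
    [FiniteDimensional ℝ V] [NormedAddCommGroup Y] [NormedSpace ℝ Y] [NormedAddCommGroup Z]
    [NormedSpace ℝ Z] [NormedAddCommGroup W] [NormedSpace ℝ W] (B : W →L[ℝ] Y →L[ℝ] Z)
    {A : V → W} (hA : ContDiff ℝ 1 A) {e : R3} {M : ℝ}
    {ψ : ℕ → R3 → V} {ψ₀ ψ₀' : R3 → V} {u : ℕ → R3 → Y} {u₀ u₀' : R3 → Y}
    (hψ : ∀ n, ContDiff ℝ 1 (ψ n)) (hu : ∀ n, ContDiff ℝ 1 (u n)) (hM : ∀ n x, ‖ψ n x‖ ≤ M)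
    (tψ : ∀ᵐ x, Tendsto (fun n => ψ n x) atTop (𝓝 (ψ₀ x)))
    (mψ' : ∀ n, MemLp (fun x => fderiv ℝ (ψ n) x e) 2) (mψ₀' : MemLp ψ₀' 2)
    (tψ' : Tendsto (fun n => l2 (fun x => fderiv ℝ (ψ n) x e - ψ₀' x)) atTop (𝓝 0))
    (mu : ∀ n, MemLp (u n) 2) (mu₀ : MemLp u₀ 2)
    (tu : Tendsto (fun n => l2 (fun x => u n x - u₀ x)) atTop (𝓝 0))
    (mu' : ∀ n, MemLp (fun x => fderiv ℝ (u n) x e) 2) (mu₀' : MemLp u₀' 2)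
    (tu' : Tendsto (fun n => l2 (fun x => fderiv ℝ (u n) x e - u₀' x)) atTop (𝓝 0))
    {φ : R3 → ℝ} (hφ : IsTestFunction φ) :
    ∫ x, (fderiv ℝ φ x e) • (B (A (ψ₀ x)) (u₀ x))
      = - ∫ x, φ x • (B (fderiv ℝ A (ψ₀ x) (ψ₀' x)) (u₀ x) + B (A (ψ₀ x)) (u₀' x)) := by
  have hA' : Continuous (fderiv ℝ A) := hA.continuous_fderiv (by norm_num)
  have hcomp := isCompact_closedBall (0 : V) M
  -- All approximants take values in one ball, compact because `V` is finite-dimensional, so `A` and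
  -- its derivative are bounded there without any growth condition.
  obtain ⟨C₀, hC₀⟩ := hcomp.exists_bound_of_continuousOn hA.continuous.continuousOn
  obtain ⟨C₁, hC₁⟩ := hcomp.exists_bound_of_continuousOn (f := fderiv ℝ A) hA'.continuousOn
  have hball : ∀ n x, ψ n x ∈ Metric.closedBall (0 : V) M := fun n x => by simpa using hM n x
  have hφ' := hφ.fderiv_apply e
  obtain ⟨Cφ, hCφ⟩ := hφ.2.exists_bound_of_continuous hφ.1.continuous
  have mφ : MemLp φ 2 volume := hφ.1.continuous.memLp_of_hasCompactSupport hφ.2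
  have mφ' : MemLp (fun x => fderiv ℝ φ x e) 2 volume :=
    hφ'.1.continuous.memLp_of_hasCompactSupport hφ'.2
  -- Turns a vector of `W` into an operator on `ℝ`, so that `ξ • B (A ψ) w` fits the form `B (K v)
  -- u` with the scalar `ξ` as the L² factor `v`.
  let J : W →L[ℝ] (ℝ →L[ℝ] W) := (ContinuousLinearMap.lsmul ℝ ℝ).flip
  have hJ : ∀ L : W, ‖J L‖ ≤ ‖L‖ := fun L =>
    ContinuousLinearMap.opNorm_le_bound _ (norm_nonneg _) fun r => by
      simp [J, norm_smul, mul_comm]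
  have eJ : ∀ (r : ℝ) (w : W) (y : Y), B (J w r) y = r • B w y := fun r w y => by simp [J]
  have zero_l2 : Tendsto (fun _ : ℕ => l2 (fun _ : R3 => (0 : ℝ))) atTop (𝓝 0) := by
    simp [l2]
  have TA : ∀ (ξ : R3 → ℝ) (_ : MemLp ξ 2) (w : ℕ → R3 → Y) (w₀ : R3 → Y) (_ : ∀ n, MemLp (w n) 2)
      (_ : MemLp w₀ 2) (_ : Tendsto (fun n => l2 (fun x => w n x - w₀ x)) atTop (𝓝 0)),
      (∀ n, Integrable (fun x => ξ x • B (A (ψ n x)) (w n x))) ∧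
      Integrable (fun x => ξ x • B (A (ψ₀ x)) (w₀ x)) ∧
      Tendsto (fun n => ∫ x, ξ x • B (A (ψ n x)) (w n x)) atTop (𝓝 (∫ x, ξ x • B (A (ψ₀ x)) (w₀ x))) := by
    intro ξ mξ w w₀ mw mw₀ tw
    have hm : ∀ n, AEStronglyMeasurable (fun x => J (A (ψ n x))) volume := fun n =>
      (J.continuous.comp (hA.continuous.comp (hψ n).continuous)).aestronglyMeasurable
    have hb : ∀ n, ∀ᵐ x, ‖J (A (ψ n x))‖ ≤ C₀ := fun n => ae_of_all _ fun x =>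
      (hJ _).trans (hC₀ _ (hball n x))
    have ht : ∀ᵐ x, Tendsto (fun n => J (A (ψ n x))) atTop (𝓝 (J (A (ψ₀ x)))) := by
      filter_upwards [tψ] with x hx
      exact ((J.continuous.comp hA.continuous).tendsto _).comp hx
    simp only [← eJ]
    exact ⟨fun n => integrable_bilinear B (hm n) (hb n) mξ (mw n),
      integrable_bilinear_of_tendsto B hm hb ht mξ mw₀,
      tendsto_integral_bilinear B (K₀ := fun x => J (A (ψ₀ x))) (v := fun _ => ξ) hm hb ht
        (fun _ => mξ) mξ (by simpa using zero_l2) mw mw₀ tw⟩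
  have TA' : (∀ n, Integrable (fun x => φ x • B (fderiv ℝ A (ψ n x) (fderiv ℝ (ψ n) x e)) (u n x))) ∧
      Integrable (fun x => φ x • B (fderiv ℝ A (ψ₀ x) (ψ₀' x)) (u₀ x)) ∧
      Tendsto (fun n => ∫ x, φ x • B (fderiv ℝ A (ψ n x) (fderiv ℝ (ψ n) x e)) (u n x)) atTop
      (𝓝 (∫ x, φ x • B (fderiv ℝ A (ψ₀ x) (ψ₀' x)) (u₀ x))) := by
    have hm : ∀ n, AEStronglyMeasurable (fun x => φ x • fderiv ℝ A (ψ n x)) volume := fun n =>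
      (hφ.1.continuous.smul (hA'.comp (hψ n).continuous)).aestronglyMeasurable
    have hb : ∀ n, ∀ᵐ x, ‖φ x • fderiv ℝ A (ψ n x)‖ ≤ Cφ * C₁ := fun n => ae_of_all _ fun x => by
      rw [norm_smul]
      exact mul_le_mul (hCφ x) (hC₁ _ (hball n x)) (norm_nonneg _) ((norm_nonneg _).trans (hCφ 0))
    have ht : ∀ᵐ x, Tendsto (fun n => φ x • fderiv ℝ A (ψ n x)) atTop
        (𝓝 (φ x • fderiv ℝ A (ψ₀ x))) := by
      filter_upwards [tψ] with x hx
      exact ((hA'.tendsto _).comp hx).const_smul _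
    have eφ : ∀ (x : R3) (L : V →L[ℝ] W) (v : V) (y : Y), φ x • B (L v) y = B ((φ x • L) v) y :=
      fun x L v y => by simp
    simp only [eφ]
    exact ⟨fun n => integrable_bilinear B (hm n) (hb n) (mψ' n) (mu n),
      integrable_bilinear_of_tendsto B hm hb ht mψ₀' mu₀,
      tendsto_integral_bilinear B (K₀ := fun x => φ x • fderiv ℝ A (ψ₀ x)) hm hb ht
        mψ' mψ₀' tψ' mu mu₀ tu⟩
  have TL := (TA _ mφ' u u₀ mu mu₀ tu)
  have TR := (TA _ mφ (fun n x => fderiv ℝ (u n) x e) u₀' mu' mu₀' tu')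
  have hd : ∀ n x, HasFDerivAt (fun x => B (A (ψ n x)) (u n x))
      ((B (A (ψ n x))).comp (fderiv ℝ (u n) x)
        + (B.comp ((fderiv ℝ A (ψ n x)).comp (fderiv ℝ (ψ n) x))).flip (u n x)) x := by
    intro n x
    have h1 : HasFDerivAt (fun x => A (ψ n x)) ((fderiv ℝ A (ψ n x)).comp (fderiv ℝ (ψ n) x)) x :=
      (hA.differentiable (by norm_num) _).hasFDerivAt.comp x
        ((hψ n).differentiable (by norm_num) x).hasFDerivAt
    exact (B.hasFDerivAt.comp x h1).clm_apply ((hu n).differentiable (by norm_num) x).hasFDerivAt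
  have hI : ∀ n, ∫ x, (fderiv ℝ φ x e) • B (A (ψ n x)) (u n x) =
      - ((∫ x, φ x • B (fderiv ℝ A (ψ n x) (fderiv ℝ (ψ n) x e)) (u n x))
        + ∫ x, φ x • B (A (ψ n x)) (fderiv ℝ (u n) x e)) := by
    intro n
    have i1 := TL.1 n
    have i2 := TA'.1 n
    have i3 := TR.1 n
    have i4 := (TA φ mφ u u₀ mu mu₀ tu).1 n
    have hdv : ∀ x, fderiv ℝ (fun x => B (A (ψ n x)) (u n x)) x e
        = B (fderiv ℝ A (ψ n x) (fderiv ℝ (ψ n) x e)) (u n x) + B (A (ψ n x)) (fderiv ℝ (u n) x e) := by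
      intro x; rw [(hd n x).fderiv]; simp [add_comm]
    have := integral_bilinear_fderiv_right_eq_neg_left_of_integrable (μ := volume)
      (f := φ) (g := fun x => B (A (ψ n x)) (u n x)) (v := e) (B := ContinuousLinearMap.lsmul ℝ ℝ)
      (by simpa using i1) (by simp only [hdv, map_add, ContinuousLinearMap.lsmul_apply]; exact i2.add i3) (by simpa using i4)
      (fun x _ => hφ.1.differentiable (by simp) x) (fun x _ => (hd n x).differentiableAt)
    simp only [ContinuousLinearMap.lsmul_apply, hdv, smul_add] at this
    rw [integral_add i2 i3] at this
    rw [this, neg_neg]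
  have := tendsto_nhds_unique (TL.2.2.congr hI) (TA'.2.2.add TR.2.2).neg
  rw [this, ← integral_add TA'.2.1 TR.2.1]
  simp only [smul_add]

end

/-! ### Pointwise estimates for the power map and its derivatives. -/

theorem rpow_sub_rpow_le {r s t : ℝ} (hr : 1 ≤ r) (hs : 0 ≤ s) (hst : s ≤ t) :
    t ^ r - s ^ r ≤ r * t ^ (r - 1) * (t - s) := by
  rcases (hs.trans hst).eq_or_lt with h0 | h0
  · have : s = 0 := le_antisymm (h0 ▸ hst) hs
    subst this; rw [← h0]; simp
  -- Bernoulli's inequality at `s / t - 1`, to be multiplied by `t ^ r`.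
  have h1 := one_add_mul_self_le_rpow_one_add (s := s / t - 1) (by have := div_nonneg hs h0.le; linarith) hr
  have h2 : (1 + (s / t - 1)) ^ r = s ^ r / t ^ r := by
    rw [add_sub_cancel, Real.div_rpow hs h0.le]
  have h3 : t ^ r = t ^ (r - 1) * t := by
    rw [← Real.rpow_add_one h0.ne']; ring_nf
  have h4 : 0 < t ^ r := Real.rpow_pos_of_pos h0 r
  rw [h2, le_div_iff₀ h4] at h1
  have h5 : (1 + r * (s / t - 1)) * t ^ r = t ^ r - r * t ^ (r - 1) * (t - s) := by
    rw [h3]; field_simp; ring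
  linarith

section Normed
variable {V : Type*} [NormedAddCommGroup V] [NormedSpace ℝ V]

theorem abs_norm_rpow_sub_le {V : Type*} [NormedAddCommGroup V] {s M : ℝ} (hs : 1 ≤ s) {z w : V} (hz : ‖z‖ ≤ M) (hw : ‖w‖ ≤ M) :
    |‖z‖ ^ s - ‖w‖ ^ s| ≤ s * M ^ (s - 1) * ‖z - w‖ := by
  wlog h : ‖w‖ ≤ ‖z‖ generalizing z w
  · rw [abs_sub_comm, norm_sub_rev]; exact this hw hz (le_of_not_ge h)
  rw [abs_of_nonneg (sub_nonneg.mpr (Real.rpow_le_rpow (norm_nonneg _) h (by linarith)))]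
  refine (rpow_sub_rpow_le hs (norm_nonneg _) h).trans ?_
  have h1 : ‖z‖ ^ (s - 1) ≤ M ^ (s - 1) := Real.rpow_le_rpow (norm_nonneg _) hz (by linarith)
  have h2 := norm_sub_norm_le z w
  have h3 : 0 ≤ ‖z‖ - ‖w‖ := by linarith
  have h4 : 0 ≤ M ^ (s - 1) := Real.rpow_nonneg ((norm_nonneg _).trans hz) _
  gcongr

/-- The power map `z ↦ |z|^b z` is Lipschitz on balls. -/
theorem norm_rpow_smul_sub_le {b M : ℝ} (hb : 0 ≤ b) {z w : V} (hz : ‖z‖ ≤ M) (hw : ‖w‖ ≤ M) :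
    ‖‖z‖ ^ b • z - ‖w‖ ^ b • w‖ ≤ (b + 2) * M ^ b * ‖z - w‖ := by
  wlog h : ‖w‖ ≤ ‖z‖ generalizing z w
  · rw [norm_sub_rev, norm_sub_rev z]; exact this hw hz (le_of_not_ge h)
  have e : ‖z‖ ^ b • z - ‖w‖ ^ b • w = ‖z‖ ^ b • (z - w) + (‖z‖ ^ b - ‖w‖ ^ b) • w := by
    rw [smul_sub, sub_smul]; abel
  have hmono : ‖w‖ ^ b ≤ ‖z‖ ^ b := Real.rpow_le_rpow (norm_nonneg _) h hb
  -- The left side is at most `‖z‖ ^ (b + 1) - ‖w‖ ^ (b + 1)`. Working with the exponent `b + 1 ≥ 1`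
  -- avoids the negative power `‖z‖ ^ (b - 1)` that would appear for `b < 1`.
  have h1 : (‖z‖ ^ b - ‖w‖ ^ b) * ‖w‖ ≤ (b + 1) * ‖z‖ ^ b * ‖z - w‖ := by
    have h2 := rpow_sub_rpow_le (r := b + 1) (by linarith) (norm_nonneg w) h
    rw [add_sub_cancel_right, Real.rpow_add_one' (norm_nonneg _) (by linarith),
      Real.rpow_add_one' (norm_nonneg _) (by linarith)] at h2
    have h3 : ‖z‖ ^ b * ‖w‖ ≤ ‖z‖ ^ b * ‖z‖ :=
      mul_le_mul_of_nonneg_left h (Real.rpow_nonneg (norm_nonneg _) _)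
    have h4 : (b + 1) * ‖z‖ ^ b * (‖z‖ - ‖w‖) ≤ (b + 1) * ‖z‖ ^ b * ‖z - w‖ :=
      mul_le_mul_of_nonneg_left (norm_sub_norm_le z w) (by positivity)
    linarith
  have h5 : ‖z‖ ^ b ≤ M ^ b := Real.rpow_le_rpow (norm_nonneg _) hz hb
  rw [e]
  refine (norm_add_le _ _).trans ?_
  rw [norm_smul, norm_smul, Real.norm_of_nonneg (Real.rpow_nonneg (norm_nonneg _) _),
    Real.norm_of_nonneg (sub_nonneg.mpr hmono)]
  calc _ ≤ (b + 2) * ‖z‖ ^ b * ‖z - w‖ := by linarith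
    _ ≤ _ := by gcongr

end Normed

/-- `P` and `P'` have norm at most `B` and distance at most `D`. -/
def PairBound {X : Type*} [NormedAddCommGroup X] (P P' : X) (B D : ℝ) : Prop :=
  ‖P‖ ≤ B ∧ ‖P'‖ ≤ B ∧ ‖P - P'‖ ≤ D

namespace PairBound
variable {X : Type*} [NormedAddCommGroup X]

theorem add {P P' Q Q' : X} {B D B₁ D₁ : ℝ} (h : PairBound P P' B D) (h₁ : PairBound Q Q' B₁ D₁) :
    PairBound (P + Q) (P' + Q') (B + B₁) (D + D₁) := by
  refine ⟨(norm_add_le _ _).trans (add_le_add h.1 h₁.1),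
    (norm_add_le _ _).trans (add_le_add h.2.1 h₁.2.1), ?_⟩
  rw [add_sub_add_comm]
  exact (norm_add_le _ _).trans (add_le_add h.2.2 h₁.2.2)

/-- A Leibniz rule for differences. Carrying size and distance together lets the bounds for
composite expressions be assembled factor by factor. -/
theorem smul [NormedSpace ℝ X] {a a' : ℝ} {v v' : X} {B D B₁ D₁ : ℝ} (h : PairBound a a' B D)
    (h₁ : PairBound v v' B₁ D₁) : PairBound (a • v) (a' • v') (B * B₁) (D * B₁ + B * D₁) := by
  have hB : 0 ≤ B := (norm_nonneg _).trans h.1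
  have hB₁ : 0 ≤ B₁ := (norm_nonneg _).trans h₁.1
  have hD : 0 ≤ D := (norm_nonneg _).trans h.2.2
  refine ⟨?_, ?_, ?_⟩
  · rw [norm_smul]; exact mul_le_mul h.1 h₁.1 (norm_nonneg _) hB
  · rw [norm_smul]; exact mul_le_mul h.2.1 h₁.2.1 (norm_nonneg _) hB
  · have e : a • v - a' • v' = (a - a') • v + a' • (v - v') := by rw [sub_smul, smul_sub]; abel
    rw [e]
    refine (norm_add_le _ _).trans (add_le_add ?_ ?_)
    · rw [norm_smul]; exact mul_le_mul h.2.2 h₁.1 (norm_nonneg _) hD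
    · rw [norm_smul]; exact mul_le_mul h.2.1 h₁.2.2 (norm_nonneg _) hB

theorem const_smul [NormedSpace ℝ X] {v v' : X} {B D c : ℝ} (hc : 0 ≤ c) (h : PairBound v v' B D) :
    PairBound (c • v) (c • v') (c * B) (c * D) := by
  refine ⟨?_, ?_, ?_⟩
  · rw [norm_smul, Real.norm_of_nonneg hc]; exact mul_le_mul_of_nonneg_left h.1 hc
  · rw [norm_smul, Real.norm_of_nonneg hc]; exact mul_le_mul_of_nonneg_left h.2.1 hc
  · rw [← smul_sub, norm_smul, Real.norm_of_nonneg hc]; exact mul_le_mul_of_nonneg_left h.2.2 hc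

theorem norm_rpow [NormedSpace ℝ X] {s M : ℝ} (hs : 1 ≤ s) {z w : X} (hz : ‖z‖ ≤ M)
    (hw : ‖w‖ ≤ M) : PairBound (‖z‖ ^ s) (‖w‖ ^ s) (M ^ s) (s * M ^ (s - 1) * ‖z - w‖) := by
  refine ⟨?_, ?_, abs_norm_rpow_sub_le hs hz hw⟩
  · rw [Real.norm_of_nonneg (by positivity)]
    exact Real.rpow_le_rpow (norm_nonneg _) hz (by linarith)
  · rw [Real.norm_of_nonneg (by positivity)]
    exact Real.rpow_le_rpow (norm_nonneg _) hw (by linarith)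

theorem real_inner {V : Type*} [NormedAddCommGroup V] [InnerProductSpace ℝ V] {u u' v v' : V}
    {B D B₁ D₁ : ℝ} (h : PairBound u u' B D) (h₁ : PairBound v v' B₁ D₁) :
    PairBound (inner ℝ u v) (inner ℝ u' v') (B * B₁) (D * B₁ + B * D₁) := by
  have hB : 0 ≤ B := (norm_nonneg _).trans h.1
  have hB₁ : 0 ≤ B₁ := (norm_nonneg _).trans h₁.1
  have hD : 0 ≤ D := (norm_nonneg _).trans h.2.2
  refine ⟨?_, ?_, ?_⟩
  · exact (norm_inner_le_norm _ _).trans (mul_le_mul h.1 h₁.1 (norm_nonneg _) hB)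
  · exact (norm_inner_le_norm _ _).trans (mul_le_mul h.2.1 h₁.2.1 (norm_nonneg _) hB)
  · have e : inner ℝ u v - inner ℝ u' v' = inner ℝ (u - u') v + inner ℝ u' (v - v') := by
      rw [inner_sub_left, inner_sub_right]; ring
    rw [e]
    refine (norm_add_le _ _).trans (add_le_add ?_ ?_)
    · exact (norm_inner_le_norm _ _).trans (mul_le_mul h.2.2 h₁.1 (norm_nonneg _) hD)
    · exact (norm_inner_le_norm _ _).trans (mul_le_mul h.2.1 h₁.2.2 (norm_nonneg _) hB)

end PairBound

section Power
variable {V : Type*} [NormedAddCommGroup V] [InnerProductSpace ℝ V]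

/-- The derivative of `z ↦ |z|^b z`. -/
noncomputable def powerDeriv (b : ℝ) (z : V) : V →L[ℝ] V :=
  ‖z‖ ^ b • ContinuousLinearMap.id ℝ V + (b * ‖z‖ ^ (b - 2)) • (innerSL ℝ z).smulRight z

/-- The second derivative of `z ↦ |z|^b z`. -/
noncomputable def powerDeriv2 (b : ℝ) (z w v : V) : V :=
  (b * ‖z‖ ^ (b - 2)) • (inner ℝ z w • v + inner ℝ w v • z + inner ℝ z v • w)
    + (b * (b - 2) * ‖z‖ ^ (b - 4)) • (inner ℝ z w * inner ℝ z v) • z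

theorem powerDeriv_apply (b : ℝ) (z v : V) :
    powerDeriv b z v = ‖z‖ ^ b • v + (b * ‖z‖ ^ (b - 2)) • inner ℝ z v • z := by
  simp [powerDeriv]

/-- The norm to a power `p` is C¹ for `p > 1`; the exponent `b - 2` demands `b > 3`. -/
theorem contDiff_powerDeriv {b : ℝ} (hb : 3 < b) : ContDiff ℝ 1 (powerDeriv b : V → V →L[ℝ] V) := by
  have h1 : ContDiff ℝ 1 (fun z : V => ‖z‖ ^ b) := contDiff_norm_rpow (by linarith)
  have h2 : ContDiff ℝ 1 (fun z : V => ‖z‖ ^ (b - 2)) := contDiff_norm_rpow (by linarith)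
  have h3 : ContDiff ℝ 1 (fun z : V => (innerSL ℝ z).smulRight z) :=
    (innerSL ℝ (E := V)).contDiff.smulRight contDiff_id
  exact (h1.smul contDiff_const).add ((contDiff_const.mul h2).smul h3)

theorem fderiv_powerDeriv_apply {b : ℝ} (hb : 3 < b) (z w v : V) :
    fderiv ℝ (powerDeriv b) z w v = powerDeriv2 b z w v := by
  have h0 : HasFDerivAt (powerDeriv b) (fderiv ℝ (powerDeriv b) z) z :=
    ((contDiff_powerDeriv hb).differentiable (by norm_num) z).hasFDerivAt
  have h1 : HasFDerivAt (fun y : V => powerDeriv b y v) ((ContinuousLinearMap.apply ℝ V v).comp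
      (fderiv ℝ (powerDeriv b) z)) z :=
    (ContinuousLinearMap.apply ℝ V v).hasFDerivAt.comp z h0
  have p1 := hasFDerivAt_norm_rpow z (p := b) (by linarith)
  have p2 := hasFDerivAt_norm_rpow z (p := b - 2) (by linarith)
  have p3 : HasFDerivAt (fun y : V => inner ℝ y v) (innerSL ℝ v) z := by
    have := (innerSL ℝ v).hasFDerivAt (x := z)
    simpa [real_inner_comm] using this
  have h2 := (p1.smul_const v).add ((p2.const_mul b).smul (p3.smul (hasFDerivAt_id z)))
  have h3 : HasFDerivAt (fun y : V => powerDeriv b y v) _ z :=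
    h2.congr_of_eventuallyEq (Filter.Eventually.of_forall fun y => by
      simp [powerDeriv_apply])
  have := congrArg (fun L => L w) (h1.unique h3)
  simp only [ContinuousLinearMap.comp_apply, ContinuousLinearMap.apply_apply] at this
  rw [this, powerDeriv2]
  have e : b - 2 - 2 = b - 4 := by ring
  simp only [_root_.add_apply, _root_.smul_apply, ContinuousLinearMap.smulRight_apply, innerSL_apply_apply,
    ContinuousLinearMap.id_apply, e, Pi.smul_apply', id, smul_eq_mul, real_inner_comm w v]
  module

/-- Lipschitz bound for `(z, v) ↦ DF(z) v` on balls, where `F(z) = |z|^b z`. -/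
theorem norm_powerDeriv_sub_le {b M : ℝ} (hb : 5 ≤ b) {z w u v : V} (hz : ‖z‖ ≤ M) (hw : ‖w‖ ≤ M) :
    ‖powerDeriv b z u - powerDeriv b w v‖ ≤
      (b + 1) ^ 3 * M ^ (b - 5) * (M ^ 4 * ‖z - w‖ * (‖u‖ + ‖v‖) + M ^ 5 * ‖u - v‖) := by
  have hM : 0 ≤ M := (norm_nonneg _).trans hz
  set m := M ^ (b - 5)
  have hm : 0 ≤ m := Real.rpow_nonneg hM _
  -- Every real power of `M` becomes `m` times a natural power, which leaves a polynomial identity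
  -- for `ring`.
  have pw : ∀ (k : ℕ) (s : ℝ), s = b - 5 + k → M ^ s = m * M ^ k := fun k s hs => by
    rw [hs, Real.rpow_add_of_nonneg hM (by linarith) (by positivity), Real.rpow_natCast]
  have Z : PairBound z w M ‖z - w‖ := ⟨hz, hw, le_rfl⟩
  have U : PairBound u v (‖u‖ + ‖v‖) ‖u - v‖ :=
    ⟨le_add_of_nonneg_right (norm_nonneg _), le_add_of_nonneg_left (norm_nonneg _), le_rfl⟩
  have N0 := PairBound.norm_rpow (s := b) (by linarith) hz hw
  have N2 := PairBound.norm_rpow (s := b - 2) (by linarith) hz hw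
  rw [pw 5 b (by push_cast; ring), pw 4 (b - 1) (by push_cast; ring)] at N0
  rw [pw 3 (b - 2) (by push_cast; ring), pw 2 (b - 2 - 1) (by push_cast; ring)] at N2
  have := ((N0.smul U).add (((N2.const_smul (c := b) (by linarith)).smul ((Z.real_inner U).smul Z)))).2.2
  rw [powerDeriv_apply, powerDeriv_apply]
  refine this.trans ?_
  set δ := ‖z - w‖
  set ℓ := ‖u‖ + ‖v‖
  set μ := ‖u - v‖
  have hδ : 0 ≤ δ := norm_nonneg _
  have hℓ : 0 ≤ ℓ := by positivity
  have hμ : 0 ≤ μ := norm_nonneg _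
  have c1 : b + b ^ 2 ≤ (b + 1) ^ 3 := by nlinarith
  have c2 : 1 + b ≤ (b + 1) ^ 3 := by nlinarith
  have a1 : 0 ≤ m * M ^ 4 * δ * ℓ := by positivity
  have a2 : 0 ≤ m * M ^ 5 * μ := by positivity
  calc _ = (b + b ^ 2) * (m * M ^ 4 * δ * ℓ) + (1 + b) * (m * M ^ 5 * μ) := by ring
    _ ≤ (b + 1) ^ 3 * (m * M ^ 4 * δ * ℓ) + (b + 1) ^ 3 * (m * M ^ 5 * μ) := by gcongr
    _ = _ := by ring

/-- Lipschitz bound for `(z, g) ↦ D²F(z)(g, g)` on balls, where `F(z) = |z|^b z`. -/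
theorem norm_powerDeriv2_sub_le {b M : ℝ} (hb : 5 ≤ b) {z w u v : V} (hz : ‖z‖ ≤ M)
    (hw : ‖w‖ ≤ M) :
    ‖powerDeriv2 b z u u - powerDeriv2 b w v v‖ ≤
      (b + 1) ^ 3 * M ^ (b - 5) * (M ^ 3 * ‖z - w‖ * (‖u‖ + ‖v‖) ^ 2
        + M ^ 4 * ((‖u‖ + ‖v‖) * ‖u - v‖)) := by
  have hM : 0 ≤ M := (norm_nonneg _).trans hz
  set m := M ^ (b - 5)
  have hm : 0 ≤ m := Real.rpow_nonneg hM _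
  have pw : ∀ (k : ℕ) (s : ℝ), s = b - 5 + k → M ^ s = m * M ^ k := fun k s hs => by
    rw [hs, Real.rpow_add_of_nonneg hM (by linarith) (by positivity), Real.rpow_natCast]
  have Z : PairBound z w M ‖z - w‖ := ⟨hz, hw, le_rfl⟩
  have U : PairBound u v (‖u‖ + ‖v‖) ‖u - v‖ :=
    ⟨le_add_of_nonneg_right (norm_nonneg _), le_add_of_nonneg_left (norm_nonneg _), le_rfl⟩
  have N2 := PairBound.norm_rpow (s := b - 2) (by linarith) hz hw
  -- The decisive use of `5 ≤ b`: the Lipschitz bound for `‖z‖ ^ (b - 4)` requires exponent at least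
  -- one.
  have N4 := PairBound.norm_rpow (s := b - 4) (by linarith) hz hw
  rw [pw 3 (b - 2) (by push_cast; ring), pw 2 (b - 2 - 1) (by push_cast; ring)] at N2
  rw [pw 1 (b - 4) (by push_cast; ring), pw 0 (b - 4 - 1) (by push_cast; ring)] at N4
  have T1 := (N2.const_smul (c := b) (by linarith)).smul
    ((((Z.real_inner U).smul U).add ((U.real_inner U).smul Z)).add ((Z.real_inner U).smul U))
  have T2 := (N4.const_smul (c := b * (b - 2)) (by nlinarith)).smul
    (((Z.real_inner U).smul (Z.real_inner U)).smul Z)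
  have := (T1.add T2).2.2
  rw [powerDeriv2, powerDeriv2]
  refine this.trans ?_
  set δ := ‖z - w‖
  set γ := ‖u‖ + ‖v‖
  set μ := ‖u - v‖
  have hδ : 0 ≤ δ := norm_nonneg _
  have hγ : 0 ≤ γ := by positivity
  have hμ : 0 ≤ μ := norm_nonneg _
  have c1 : b * (b + 1) * (b - 1) ≤ (b + 1) ^ 3 := by nlinarith
  have c2 : 2 * b * (b + 1) ≤ (b + 1) ^ 3 := by nlinarith
  have a1 : 0 ≤ m * M ^ 3 * δ * γ ^ 2 := by positivity
  have a2 : 0 ≤ m * M ^ 4 * (γ * μ) := by positivity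
  calc _ = (b * (b + 1) * (b - 1)) * (m * M ^ 3 * δ * γ ^ 2)
        + (2 * b * (b + 1)) * (m * M ^ 4 * (γ * μ)) := by ring
    _ ≤ (b + 1) ^ 3 * (m * M ^ 3 * δ * γ ^ 2) + (b + 1) ^ 3 * (m * M ^ 4 * (γ * μ)) := by gcongr
    _ = _ := by ring

end Power

/-- Convexity for `s ≥ 1`, subadditivity for `s ≤ 1`. Nonemptiness matters: for `N = 0` and `s = 0`
the left side is `0 ^ 0 = 1` and the right side is zero. -/
theorem sum_rpow_le_card_rpow_mul {N : ℕ} (a : Fin N → ℝ) (ha : ∀ j, 0 ≤ a j) (hN : 0 < N) {s : ℝ}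
    (hs : 0 ≤ s) : (∑ j, a j) ^ s ≤ (N : ℝ) ^ max (s - 1) 0 * ∑ j, a j ^ s := by
  rcases le_total 1 s with h | h
  · rw [max_eq_left (by linarith)]
    have := Real.rpow_sum_le_const_mul_sum_rpow (Finset.univ : Finset (Fin N)) a h
    simpa [abs_of_nonneg, ha, Finset.sum_nonneg] using this
  · rw [max_eq_right (by linarith), Real.rpow_zero, one_mul]
    have : Nonempty (Fin N) := ⟨⟨0, hN⟩⟩
    have : ∀ t : Finset (Fin N), t.Nonempty → (∑ j ∈ t, a j) ^ s ≤ ∑ j ∈ t, a j ^ s := by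
      intro t ht
      induction ht using Finset.Nonempty.cons_induction with
      | singleton i => simp
      | cons i t hi ht ih =>
        rw [Finset.sum_cons, Finset.sum_cons]
        exact (Real.rpow_add_le_add_rpow (ha i) (Finset.sum_nonneg fun j _ => ha j) hs h).trans
          (by gcongr)
    exact this _ Finset.univ_nonempty

/-! ### Real-valued L² and L⁴ norms, and vectors of Schwartz functions. -/

section
open Filter Topology
open scoped SchwartzMap LineDeriv

section L2
variable {X : Type*} [NormedAddCommGroup X]

theorem l2_le_of_ae_norm_le {Y : Type*} [NormedAddCommGroup Y] {f : R3 → X} {g : R3 → Y}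
    (hg : MemLp g 2) (h : ∀ᵐ x, ‖f x‖ ≤ ‖g x‖) : l2 f ≤ l2 g :=
  ENNReal.toReal_mono hg.2.ne (eLpNorm_mono_ae h)

theorem l2_add_le {f g : R3 → X} (hf : MemLp f 2) (hg : MemLp g 2) :
    l2 (fun x => f x + g x) ≤ l2 f + l2 g := by
  rw [l2, l2, l2, ← ENNReal.toReal_add hf.2.ne hg.2.ne]
  exact ENNReal.toReal_mono (ENNReal.add_ne_top.2 ⟨hf.2.ne, hg.2.ne⟩)
    (eLpNorm_add_le hf.1 hg.1 (by norm_num))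

theorem l2_sum_le {ι : Type*} {s : Finset ι} {f : ι → R3 → X} (hf : ∀ i ∈ s, MemLp (f i) 2) :
    l2 (fun x => ∑ i ∈ s, f i x) ≤ ∑ i ∈ s, l2 (f i) := by
  simp only [l2]
  rw [← ENNReal.toReal_sum fun i hi => (hf i hi).2.ne]
  refine ENNReal.toReal_mono (ENNReal.sum_ne_top.2 fun i hi => (hf i hi).2.ne) ?_
  have : (fun x => ∑ i ∈ s, f i x) = ∑ i ∈ s, f i := by ext x; simp
  rw [this]
  exact eLpNorm_sum_le (fun i hi => (hf i hi).1) (by norm_num)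

theorem l2_const_smul [NormedSpace ℝ X] (c : ℝ) (f : R3 → X) :
    l2 (fun x => c • f x) = |c| * l2 f := by
  have := eLpNorm_const_smul (μ := (volume : Measure R3)) c f 2
  rw [l2, l2, show (fun x => c • f x) = c • f from rfl, this, ENNReal.toReal_mul]
  simp

theorem l2_norm (f : R3 → X) : l2 (fun x => ‖f x‖) = l2 f := by
  rw [l2, l2, eLpNorm_norm]

/-- The `L⁴` norm as a real number. -/
noncomputable def l4 {G : Type*} [NormedAddCommGroup G] (f : R3 → G) : ℝ :=
  (eLpNorm f 4 volume).toReal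

theorem l4_nonneg (f : R3 → X) : 0 ≤ l4 f := ENNReal.toReal_nonneg

theorem l4_norm (f : R3 → X) : l4 (fun x => ‖f x‖) = l4 f := by
  rw [l4, l4, eLpNorm_norm]

theorem l4_add_le {f g : R3 → X} (hf : MemLp f 4) (hg : MemLp g 4) :
    l4 (fun x => f x + g x) ≤ l4 f + l4 g := by
  rw [l4, l4, l4, ← ENNReal.toReal_add hf.2.ne hg.2.ne]
  exact ENNReal.toReal_mono (ENNReal.add_ne_top.2 ⟨hf.2.ne, hg.2.ne⟩)
    (eLpNorm_add_le hf.1 hg.1 (by norm_num))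

instance : ENNReal.HolderTriple 4 4 2 where
  inv_add_inv_eq_inv := by
    rw [← two_mul, show (4 : ℝ≥0∞) = 2 * 2 by norm_num,
      ENNReal.mul_inv (by norm_num) (by norm_num), ← mul_assoc,
      ENNReal.mul_inv_cancel (by norm_num) (by norm_num), one_mul]

theorem memLp_two_mul {f g : R3 → ℝ} (hf : MemLp f 4) (hg : MemLp g 4) :
    MemLp (fun x => f x * g x) 2 := hg.mul (p := 4) hf

theorem l2_mul_le {f g : R3 → ℝ} (hf : MemLp f 4) (hg : MemLp g 4) :
    l2 (fun x => f x * g x) ≤ l4 f * l4 g := by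
  rw [l2, l4, l4, ← ENNReal.toReal_mul]
  refine ENNReal.toReal_mono (ENNReal.mul_ne_top hf.2.ne hg.2.ne) ?_
  have := eLpNorm_smul_le_mul_eLpNorm (p := 4) (q := 4) (r := 2) hg.1 hf.1
  rwa [smul_eq_mul] at this

theorem l2_norm_sq (f : R3 → X) : l2 (fun x => ‖f x‖ ^ 2) = l4 f ^ 2 := by
  have := eLpNorm_norm_rpow (μ := (volume : Measure R3)) (p := 2) (q := 2) f (by norm_num)
  simp only [Real.rpow_ofNat, ENNReal.ofReal_ofNat] at this
  rw [l2, l4, this, ← ENNReal.toReal_rpow, show (2 : ℝ≥0∞) * 2 = 4 by norm_num]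
  simp

end L2

section Euclidean
variable {N : ℕ}

theorem l2_sq_eq_sum {f : R3 → EuclideanSpace ℂ (Fin N)} (hf : MemLp f 2) :
    l2 f ^ 2 = ∑ k, l2 (fun x => f x k) ^ 2 := by
  have hk := memLp_piLp_iff.1 hf
  rw [l2_sq hf, Finset.sum_congr rfl fun k _ => l2_sq (hk k)]
  simp only [EuclideanSpace.norm_sq_eq]
  exact integral_finsetSum _ fun k _ => (hk k).norm.integrable_sq

/-- The triangle inequality in L² for `∑ ‖f k‖²`; working with the squared L⁴ norm keeps the number
of components out of the constant. -/
theorem l4_sq_le_sum {f : R3 → EuclideanSpace ℂ (Fin N)} (hf : MemLp f 4) :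
    l4 f ^ 2 ≤ ∑ k, l4 (fun x => f x k) ^ 2 := by
  have hk := memLp_piLp_iff.1 hf
  simp only [← l2_norm_sq, EuclideanSpace.norm_sq_eq]
  refine l2_sum_le fun k _ => ?_
  simp only [pow_two]
  exact memLp_two_mul (hk k).norm (hk k).norm

/-- The function with given Schwartz components. -/
noncomputable def schwartzVec (F : Fin N → 𝓢(R3, ℂ)) (x : R3) : EuclideanSpace ℂ (Fin N) :=
  WithLp.toLp 2 fun k => F k x

theorem hasFDerivAt_schwartzVec (F : Fin N → 𝓢(R3, ℂ)) (x : R3) :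
    HasFDerivAt (schwartzVec F) ((PiLp.continuousLinearEquiv 2 ℝ (fun _ : Fin N => ℂ)).symm.toContinuousLinearMap.comp
      (ContinuousLinearMap.pi fun k => fderiv ℝ (F k) x)) x :=
  (PiLp.continuousLinearEquiv 2 ℝ (fun _ : Fin N => ℂ)).symm.hasFDerivAt.comp x
    (hasFDerivAt_pi.2 fun k => (F k).differentiableAt.hasFDerivAt)

theorem fderiv_schwartzVec (F : Fin N → 𝓢(R3, ℂ)) (x v : R3) :
    fderiv ℝ (schwartzVec F) x v = schwartzVec (fun k => ∂_{v} (F k)) x := by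
  rw [(hasFDerivAt_schwartzVec F x).fderiv]
  ext k
  simp [schwartzVec, SchwartzMap.lineDerivOp_apply_eq_fderiv]

theorem contDiff_schwartzVec (F : Fin N → 𝓢(R3, ℂ)) : ContDiff ℝ 1 (schwartzVec F) :=
  (PiLp.continuousLinearEquiv 2 ℝ (fun _ : Fin N => ℂ)).symm.contDiff.comp
    (contDiff_pi.2 fun k => (F k).smooth 1)

theorem memLp_schwartzVec (F : Fin N → 𝓢(R3, ℂ)) : MemLp (schwartzVec F) 2 :=
  memLp_piLp_iff.2 fun k => (F k).memLp 2 volume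

theorem tendsto_l2_of_apply {F : ℕ → R3 → EuclideanSpace ℂ (Fin N)} {f : R3 → EuclideanSpace ℂ (Fin N)}
    (hF : ∀ n, MemLp (F n) 2) (hf : MemLp f 2)
    (h : ∀ k, Tendsto (fun n => eLpNorm (fun x => F n x k - f x k) 2 volume) atTop (𝓝 0)) :
    Tendsto (fun n => l2 (fun x => F n x - f x)) atTop (𝓝 0) := by
  have h1 : Tendsto (fun n => ∑ k, l2 (fun x => F n x k - f x k) ^ 2) atTop (𝓝 0) := by
    have := tendsto_finsetSum Finset.univ fun k _ =>
      (((ENNReal.tendsto_toReal ENNReal.zero_ne_top).comp (h k)).pow 2)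
    simpa [l2] using this
  have h2 : ∀ n, l2 (fun x => F n x - f x) = √(∑ k, l2 (fun x => F n x k - f x k) ^ 2) := fun n => by
    have := l2_sq_eq_sum (f := fun x => F n x - f x) ((hF n).sub hf)
    rw [← Real.sqrt_sq (l2_nonneg (fun x => F n x - f x)), this]
    rfl
  simp only [h2]
  simpa using h1.sqrt

end Euclidean

end

/-! ### The vector-valued space (H²)^N and its embeddings. -/

section
open Filter Topology
open scoped SchwartzMap LineDeriv

/-- `ψ ∈ (H²)^N` with weak gradient `G` and weak Hessian `H`. -/
def HasH2DerivsVec {N : ℕ} (ψ : R3 → EuclideanSpace ℂ (Fin N))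
    (G : Fin 3 → R3 → EuclideanSpace ℂ (Fin N))
    (H : Fin 3 → Fin 3 → R3 → EuclideanSpace ℂ (Fin N)) : Prop :=
  ∀ k, HasH2Derivs (fun x => ψ x k) (fun i x => G i x k) (fun i j x => H i j x k)

variable {N : ℕ} {ψ ψ' : R3 → EuclideanSpace ℂ (Fin N)}
  {G G' : Fin 3 → R3 → EuclideanSpace ℂ (Fin N)}
  {H H' : Fin 3 → Fin 3 → R3 → EuclideanSpace ℂ (Fin N)}

theorem memH2Vec_iff : MemH2Vec ψ ↔ ∃ G H, HasH2DerivsVec ψ G H := by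
  constructor
  · intro h
    choose g h H using fun k => memH2_iff.1 (h k)
    exact ⟨fun i x => WithLp.toLp 2 fun k => g k i x, fun i j x => WithLp.toLp 2 fun k => h k i j x, H⟩
  · rintro ⟨G, H, h⟩ k
    exact memH2_iff.2 ⟨_, _, h k⟩

namespace HasH2DerivsVec

theorem memLp (h : HasH2DerivsVec ψ G H) : MemLp ψ 2 := memLp_piLp_iff.2 fun k => (h k).memLp

theorem memLp_grad (h : HasH2DerivsVec ψ G H) (i : Fin 3) : MemLp (G i) 2 :=
  memLp_piLp_iff.2 fun k => ((h k).grad i).1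

theorem memLp_hess (h : HasH2DerivsVec ψ G H) (i j : Fin 3) : MemLp (H i j) 2 :=
  memLp_piLp_iff.2 fun k => ((h k).hess i j).1

theorem memLp_trace (h : HasH2DerivsVec ψ G H) : MemLp (fun x => ∑ i, H i i x) 2 :=
  memLp_finsetSum _ fun i _ => h.memLp_hess i i

theorem sub (h : HasH2DerivsVec ψ G H) (h' : HasH2DerivsVec ψ' G' H') :
    HasH2DerivsVec (fun x => ψ x - ψ' x) (fun i x => G i x - G' i x)
      (fun i j x => H i j x - H' i j x) := fun k => (h k).sub (h' k)

/-- Squared L² norms add over components, so the norm sees only the vector fields `ψ` and `Δψ`; no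
other second derivative has to be estimated. -/
theorem normH2Vec_sq (h : HasH2DerivsVec ψ G H) :
    normH2Vec ψ ^ 2 = l2 ψ ^ 2 + l2 (fun x => ∑ i, H i i x) ^ 2 := by
  rw [normH2Vec, Real.sq_sqrt (Finset.sum_nonneg fun _ _ => sq_nonneg _), l2_sq_eq_sum h.memLp,
    l2_sq_eq_sum h.memLp_trace, ← Finset.sum_add_distrib]
  refine Finset.sum_congr rfl fun k _ => ?_
  rw [(h k).normH2_eq, Real.sq_sqrt (by positivity)]
  simp

end HasH2DerivsVec

theorem normH2Vec_nonneg (ψ : R3 → EuclideanSpace ℂ (Fin N)) : 0 ≤ normH2Vec ψ := Real.sqrt_nonneg _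

theorem normH2_nonneg (f : R3 → ℂ) : 0 ≤ normH2 f := Real.sqrt_nonneg _

theorem sq_normH2Vec (ψ : R3 → EuclideanSpace ℂ (Fin N)) :
    normH2Vec ψ ^ 2 = ∑ k, normH2 (fun x => ψ x k) ^ 2 :=
  Real.sq_sqrt (Finset.sum_nonneg fun _ _ => sq_nonneg _)

namespace HasH2DerivsVec

theorem l2_le (h : HasH2DerivsVec ψ G H) : l2 ψ ≤ normH2Vec ψ :=
  (sq_le_sq₀ (l2_nonneg _) (normH2Vec_nonneg _)).1 (by rw [h.normH2Vec_sq]; nlinarith [l2_nonneg ψ])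

theorem l2_trace_le (h : HasH2DerivsVec ψ G H) : l2 (fun x => ∑ i, H i i x) ≤ normH2Vec ψ :=
  (sq_le_sq₀ (l2_nonneg _) (normH2Vec_nonneg _)).1 (by rw [h.normH2Vec_sq]; nlinarith [l2_nonneg ψ])

theorem normH2Vec_le (h : HasH2DerivsVec ψ G H) :
    normH2Vec ψ ≤ l2 ψ + l2 (fun x => ∑ i, H i i x) := by
  have h1 := l2_nonneg ψ
  have h2 := l2_nonneg (fun x => ∑ i, H i i x)
  refine (sq_le_sq₀ (normH2Vec_nonneg _) (by positivity)).1 ?_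
  rw [h.normH2Vec_sq]; nlinarith

end HasH2DerivsVec

/-- The embeddings `H² ⊂ L^∞` and `∇H² ⊂ L⁴` for a constant that does not depend on `N`. -/
theorem exists_h2Vec_bounds : ∃ C : ℝ, 0 < C ∧
    (∀ f : R3 → ℂ, MemH2 f → ∀ᵐ x, ‖f x‖ ≤ C * normH2 f) ∧
    ∀ (N : ℕ) (ψ : R3 → EuclideanSpace ℂ (Fin N)) G H, HasH2DerivsVec ψ G H →
      (∀ᵐ x, ‖ψ x‖ ≤ C * normH2Vec ψ) ∧ ∀ i, MemLp (G i) 4 ∧ l4 (G i) ≤ C * normH2Vec ψ := by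
  obtain ⟨C, hC, hb⟩ := exists_h2_bounds
  have hsup : ∀ f : R3 → ℂ, MemH2 f → ∀ᵐ x, ‖f x‖ ≤ C * normH2 f := fun f hf => by
    obtain ⟨g, h, H⟩ := memH2_iff.1 hf
    rw [H.normH2_eq]
    exact (hb f g h H).1
  refine ⟨C, hC, hsup, fun N ψ G H h => ⟨?_, fun i => ?_⟩⟩
  · filter_upwards [ae_all_iff.2 fun k => hsup _ (memH2Vec_iff.2 ⟨G, H, h⟩ k)] with x hx
    have hn := normH2Vec_nonneg ψ
    -- Componentwise bounds are squared and summed, so the scalar constant `C` serves every `N`.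
    refine (sq_le_sq₀ (norm_nonneg _) (by positivity)).1 ?_
    rw [mul_pow, sq_normH2Vec, EuclideanSpace.norm_sq_eq, Finset.mul_sum]
    refine Finset.sum_le_sum fun k _ => ?_
    rw [← mul_pow]
    exact pow_le_pow_left₀ (norm_nonneg _) (hx k) 2
  · have hk : ∀ k, eLpNorm (fun x => G i x k) 4 volume
        ≤ ENNReal.ofReal (C * normH2 (fun x => ψ x k)) := fun k => by
      rw [(h k).normH2_eq]
      exact (hb _ _ _ (h k)).2 i
    have hG : MemLp (G i) 4 := memLp_piLp_iff.2 fun k =>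
      ⟨((h k).grad i).1.1, (hk k).trans_lt ENNReal.ofReal_lt_top⟩
    have hn := normH2Vec_nonneg ψ
    refine ⟨hG, (sq_le_sq₀ (l4_nonneg _) (by positivity)).1 ((l4_sq_le_sum hG).trans ?_)⟩
    rw [mul_pow, sq_normH2Vec, Finset.mul_sum]
    refine Finset.sum_le_sum fun k _ => ?_
    rw [← mul_pow]
    have hnk := normH2_nonneg (fun x => ψ x k)
    exact pow_le_pow_left₀ (l4_nonneg _) (ENNReal.toReal_le_of_le_ofReal (by positivity) (hk k)) 2

/-- The sup norms are controlled by the H² norms of the approximants, and these are bounded by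
convergence. The product rule needs this uniform bound. -/
theorem HasH2Derivs.exists_norm_approx_le {f : R3 → ℂ} {g : Fin 3 → R3 → ℂ}
    {h : Fin 3 → Fin 3 → R3 → ℂ} (H : HasH2Derivs f g h) {F : ℕ → 𝓢(R3, ℂ)}
    (hF : Tendsto (fun n => eLpNorm (fun x => F n x - f x) 2 volume) atTop (𝓝 0))
    (hH : ∀ i j, Tendsto (fun n => eLpNorm (fun x =>
      (∂_{basisVec j} (∂_{basisVec i} (F n) : 𝓢(R3, ℂ)) : 𝓢(R3, ℂ)) x - h i j x) 2 volume)
      atTop (𝓝 0)) : ∃ M, ∀ n x, ‖F n x‖ ≤ M := by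
  obtain ⟨C, hC, hS⟩ := exists_schwartz_h2_bounds
  let D : Fin 3 → ℕ → 𝓢(R3, ℂ) := fun i n => ∂_{basisVec i} (∂_{basisVec i} (F n) : 𝓢(R3, ℂ))
  have mD : ∀ i n, MemLp (D i n) 2 volume := fun i n => (D i n).memLp 2 volume
  have tL : Tendsto (fun n => ∑ i, l2 (D i n)) atTop (𝓝 (∑ i, l2 (h i i))) :=
    tendsto_finsetSum _ fun i _ =>
      tendsto_l2_of_eLpNorm_sub (mD i) (H.hess i i).1 (hH i i)
  have t1 := tendsto_l2_of_eLpNorm_sub (fun n => (F n).memLp 2 volume) H.memLp hF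
  obtain ⟨M, hM⟩ := ((t1.add tL).const_mul C).bddAbove_range
  refine ⟨M, fun n x => ((hS (F n)).1 x).trans (le_trans ?_ (hM ⟨n, rfl⟩))⟩
  have hle : l2 (schwartzLaplacian (F n)) ≤ ∑ i, l2 (D i n) := by
    have e : (schwartzLaplacian (F n) : R3 → ℂ) = fun x => ∑ i, D i n x := by
      ext x; simp [schwartzLaplacian, D]
    rw [e]
    exact l2_sum_le fun i _ => mD i n
  have key : ∀ {a b c : ℝ}, 0 ≤ a → 0 ≤ b → b ≤ c → √(a ^ 2 + b ^ 2) ≤ a + c := fun ha hb hbc =>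
    Real.sqrt_le_iff.2 ⟨by linarith, by nlinarith⟩
  exact mul_le_mul_of_nonneg_left (key (l2_nonneg _) (l2_nonneg _) hle) hC.le

/-- Simultaneous smooth approximation of `ψ ∈ (H²)^N` and of its derivatives. -/
theorem HasH2DerivsVec.exists_approx (h : HasH2DerivsVec ψ G H) :
    ∃ (F : ℕ → Fin N → 𝓢(R3, ℂ)) (M : ℝ), (∀ n x, ‖schwartzVec (F n) x‖ ≤ M) ∧
      (∀ᵐ x, Tendsto (fun n => schwartzVec (F n) x) atTop (𝓝 (ψ x))) ∧
      Tendsto (fun n => l2 (fun x => schwartzVec (F n) x - ψ x)) atTop (𝓝 0) ∧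
      (∀ i, Tendsto (fun n => l2 (fun x =>
        schwartzVec (fun k => ∂_{basisVec i} (F n k)) x - G i x)) atTop (𝓝 0)) ∧
      ∀ i j, Tendsto (fun n => l2 (fun x =>
        schwartzVec (fun k => ∂_{basisVec j} (∂_{basisVec i} (F n k) : 𝓢(R3, ℂ))) x - H i j x)) atTop (𝓝 0) := by
  choose F hF hG hH using fun k => exists_schwartz_approx (h k).memLp (h k).grad (h k).hess
  have t0 : Tendsto (fun n => l2 (fun x => schwartzVec (fun k => F k n) x - ψ x)) atTop (𝓝 0) :=
    tendsto_l2_of_apply (fun n => memLp_schwartzVec _) h.memLp hF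
  have e0 : Tendsto (fun n => eLpNorm (fun x => schwartzVec (fun k => F k n) x - ψ x) 2 volume)
      atTop (𝓝 0) := by
    refine (ENNReal.tendsto_toReal_iff (fun n => ((memLp_schwartzVec _).sub h.memLp).2.ne) (by simp)).1 t0
  -- One subsequence for the whole vector; the L² limits are inherited by it.
  obtain ⟨ns, hns, hae⟩ := exists_subseq_tendsto_ae (fun n => memLp_schwartzVec _) h.memLp e0
  have hT := fun k => (h k).exists_norm_approx_le (hF k) (hH k)
  choose M hM using hT
  refine ⟨fun n k => F k (ns n), √(∑ k, M k ^ 2), fun n x => ?_, hae, t0.comp hns.tendsto_atTop,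
    fun i => ?_, fun i j => ?_⟩
  · rw [EuclideanSpace.norm_eq]
    exact Real.sqrt_le_sqrt (Finset.sum_le_sum fun k _ => pow_le_pow_left₀ (norm_nonneg _) (hM k _ x) 2)
  · exact tendsto_l2_of_apply (fun n => memLp_schwartzVec _) (h.memLp_grad i)
      fun k => (hG k i).comp hns.tendsto_atTop
  · exact tendsto_l2_of_apply (fun n => memLp_schwartzVec _) (h.memLp_hess i j)
      fun k => (hH k i j).comp hns.tendsto_atTop

end

/-! ### The chain rule for the power non-linearity in (H²)^N. -/

section
open Filter Topology
open scoped SchwartzMap LineDeriv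

section PowerContinuity
variable {V : Type*} [NormedAddCommGroup V] [InnerProductSpace ℝ V]

theorem aestronglyMeasurable_powerDeriv {b : ℝ} (hb : 3 < b) {f v : R3 → V}
    (hf : AEStronglyMeasurable f volume) (hv : AEStronglyMeasurable v volume) :
    AEStronglyMeasurable (fun x => powerDeriv b (f x) (v x)) volume := by
  have : Continuous (fun p : V × V => powerDeriv b p.1 p.2) :=
    ((contDiff_powerDeriv hb).continuous.comp continuous_fst).clm_apply continuous_snd
  exact Continuous.comp_aestronglyMeasurable₂ (g := fun z y => powerDeriv b z y) this hf hv

theorem aestronglyMeasurable_powerDeriv2 {b : ℝ} (hb : 3 < b) {f w v : R3 → V}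
    (hf : AEStronglyMeasurable f volume) (hw : AEStronglyMeasurable w volume)
    (hv : AEStronglyMeasurable v volume) :
    AEStronglyMeasurable (fun x => powerDeriv2 b (f x) (w x) (v x)) volume := by
  have : Continuous (fun p : V × V × V => powerDeriv2 b p.1 p.2.1 p.2.2) := by
    simp only [← fderiv_powerDeriv_apply hb]
    exact (((((contDiff_powerDeriv hb).continuous_fderiv one_ne_zero).comp
      continuous_fst).clm_apply (continuous_fst.comp continuous_snd))).clm_apply
        (continuous_snd.comp continuous_snd)
  exact this.comp_aestronglyMeasurable (hf.prodMk (hw.prodMk hv))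

theorem aestronglyMeasurable_norm_rpow_smul {V : Type*} [NormedAddCommGroup V] [NormedSpace ℝ V]
    {b : ℝ} (hb : 0 ≤ b) {f : R3 → V} (hf : AEStronglyMeasurable f volume) :
    AEStronglyMeasurable (fun x => ‖f x‖ ^ b • f x) volume := by
  have : Continuous (fun z : V => ‖z‖ ^ b • z) :=
    (continuous_norm.rpow_const fun _ => Or.inr hb).smul continuous_id
  exact this.comp_aestronglyMeasurable hf

/-- Compactness gives a constant with no control in `N`; this suffices, as it only serves membership
in L². -/
theorem exists_norm_powerDeriv_le [FiniteDimensional ℝ V] {b : ℝ} (hb : 3 < b) (M : ℝ) :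
    ∃ C, ∀ z : V, ‖z‖ ≤ M → ∀ v w, ‖powerDeriv b z v‖ ≤ C * ‖v‖ ∧
      ‖powerDeriv2 b z w v‖ ≤ C * (‖w‖ * ‖v‖) := by
  have hA := contDiff_powerDeriv (V := V) hb
  have hcomp := isCompact_closedBall (0 : V) M
  obtain ⟨C₀, h₀⟩ := hcomp.exists_bound_of_continuousOn hA.continuous.continuousOn
  obtain ⟨C₁, h₁⟩ := hcomp.exists_bound_of_continuousOn (f := fderiv ℝ (powerDeriv b))
    (hA.continuous_fderiv one_ne_zero).continuousOn
  refine ⟨max C₀ C₁, fun z hz v w => ⟨?_, ?_⟩⟩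
  · refine ((powerDeriv b z).le_opNorm v).trans ?_
    exact mul_le_mul_of_nonneg_right ((h₀ z (by simpa using hz)).trans (le_max_left _ _))
      (norm_nonneg _)
  · rw [← fderiv_powerDeriv_apply hb, ← mul_assoc]
    refine (ContinuousLinearMap.le_opNorm _ v).trans (mul_le_mul_of_nonneg_right ?_ (norm_nonneg _))
    refine (ContinuousLinearMap.le_opNorm _ w).trans (mul_le_mul_of_nonneg_right ?_ (norm_nonneg _))
    exact (h₁ z (by simpa using hz)).trans (le_max_right _ _)

theorem fderiv_norm_rpow_smul_add {b : ℝ} (hb : 1 < b) (z v : V) :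
    fderiv ℝ (fun y : V => ‖y‖ ^ b) z v • z + ‖z‖ ^ b • v = powerDeriv b z v := by
  rw [(hasFDerivAt_norm_rpow z hb).fderiv, powerDeriv_apply, add_comm]
  simp [smul_smul]

end PowerContinuity

section
variable {N : ℕ} {ψ : R3 → EuclideanSpace ℂ (Fin N)}
  {G : Fin 3 → R3 → EuclideanSpace ℂ (Fin N)}
  {H : Fin 3 → Fin 3 → R3 → EuclideanSpace ℂ (Fin N)}

theorem isWeakPartial_apply {i : Fin 3} {f g : R3 → EuclideanSpace ℂ (Fin N)} (hf : MemLp f 2)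
    (hg : MemLp g 2) (h : ∀ φ : R3 → ℝ, IsTestFunction φ →
      ∫ x, (fderiv ℝ φ x (basisVec i)) • f x = - ∫ x, φ x • g x) (k : Fin N) :
    IsWeakPartial i (fun x => f x k) (fun x => g x k) := by
  refine ⟨(memLp_piLp_iff.1 hf k).locallyIntegrable (by norm_num),
    (memLp_piLp_iff.1 hg k).locallyIntegrable (by norm_num), fun φ hφ => ?_⟩
  have hφ' := hφ.fderiv_apply (basisVec i)
  have h1 := eval_integral_piLp (integrable_piLp_iff.1
    (integrable_smul_of_memLp_two hφ'.1.continuous hφ'.2 hf)) k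
  have h2 := eval_integral_piLp (integrable_piLp_iff.1
    (integrable_smul_of_memLp_two hφ.1.continuous hφ.2 hg)) k
  rw [h φ hφ] at h1
  simp only [PiLp.neg_apply, h2, PiLp.smul_apply] at h1
  exact h1.symm

theorem fderiv_schwartzVec_eq (F : Fin N → 𝓢(R3, ℂ)) (v : R3) :
    (fun x => fderiv ℝ (schwartzVec F) x v) = schwartzVec (fun k => ∂_{v} (F k)) :=
  funext fun x => fderiv_schwartzVec F x v

/-- The power nonlinearity maps `(H²)^N` to itself, and its derivatives obey the chain rule. -/
theorem HasH2DerivsVec.norm_rpow_smul {b : ℝ} (hb : 5 ≤ b) (h : HasH2DerivsVec ψ G H) {M : ℝ}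
    (hM : ∀ᵐ x, ‖ψ x‖ ≤ M) (h4 : ∀ i, MemLp (G i) 4) :
    HasH2DerivsVec (fun x => ‖ψ x‖ ^ b • ψ x) (fun i x => powerDeriv b (ψ x) (G i x))
      (fun i j x => powerDeriv2 b (ψ x) (G j x) (G i x) + powerDeriv b (ψ x) (H i j x)) := by
  have hb3 : 3 < b := by linarith
  obtain ⟨C, hC⟩ := exists_norm_powerDeriv_le (V := EuclideanSpace ℂ (Fin N)) hb3 M
  have mD : ∀ {v : R3 → EuclideanSpace ℂ (Fin N)}, MemLp v 2 →
      MemLp (fun x => powerDeriv b (ψ x) (v x)) 2 := fun {v} hv => by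
    refine hv.of_le_mul (c := C) (aestronglyMeasurable_powerDeriv hb3 h.memLp.1 hv.1) ?_
    filter_upwards [hM] with x hx using (hC _ hx _ 0).1
  have mP : MemLp (fun x => ‖ψ x‖ ^ b • ψ x) 2 := by
    refine h.memLp.of_le_mul (c := M ^ b)
      (aestronglyMeasurable_norm_rpow_smul (by linarith) h.memLp.1) ?_
    filter_upwards [hM] with x hx
    rw [norm_smul, Real.norm_of_nonneg (by positivity)]
    gcongr
  have mQ : ∀ i j, MemLp (fun x => powerDeriv2 b (ψ x) (G j x) (G i x)) 2 := fun i j => by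
    refine (memLp_two_mul (h4 j).norm (h4 i).norm).of_le_mul (c := C)
      (aestronglyMeasurable_powerDeriv2 hb3 h.memLp.1 (h4 j).1 (h4 i).1) ?_
    filter_upwards [hM] with x hx
    rw [Real.norm_of_nonneg (by positivity)]
    exact (hC _ hx _ _).2
  obtain ⟨F, M', hF, ae0, t0, t1, t2⟩ := h.exists_approx
  have mS := fun (K : Fin N → 𝓢(R3, ℂ)) => memLp_schwartzVec K
  intro k
  refine ⟨memLp_piLp_iff.1 mP k, fun i => ⟨memLp_piLp_iff.1 (mD (h.memLp_grad i)) k, ?_⟩,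
    fun i j => ⟨memLp_piLp_iff.1 ((mQ i j).add (mD (h.memLp_hess i j))) k, ?_⟩⟩
  · refine isWeakPartial_apply mP (mD (h.memLp_grad i)) (fun φ hφ => ?_) k
    -- First derivatives: the product of the scalar `‖ψ‖ ^ b` with `ψ` itself.
    have := integral_weak_product_rule (ContinuousLinearMap.lsmul ℝ ℝ :
        ℝ →L[ℝ] EuclideanSpace ℂ (Fin N) →L[ℝ] EuclideanSpace ℂ (Fin N))
      (A := fun z : EuclideanSpace ℂ (Fin N) => ‖z‖ ^ b) (contDiff_norm_rpow (by linarith))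
      (e := basisVec i) (ψ := fun n => schwartzVec (F n)) (u := fun n => schwartzVec (F n))
      (fun n => contDiff_schwartzVec _) (fun n => contDiff_schwartzVec _) hF ae0
      (fun n => by rw [fderiv_schwartzVec_eq]; exact mS _) (h.memLp_grad i)
      (by simpa only [fderiv_schwartzVec] using t1 i) (fun n => mS _) h.memLp t0
      (fun n => by rw [fderiv_schwartzVec_eq]; exact mS _) (h.memLp_grad i)
      (by simpa only [fderiv_schwartzVec] using t1 i) hφ
    simpa only [ContinuousLinearMap.lsmul_apply,
      fderiv_norm_rpow_smul_add (by linarith : 1 < b)] using this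
  · refine isWeakPartial_apply (mD (h.memLp_grad i)) ((mQ i j).add (mD (h.memLp_hess i j)))
      (fun φ hφ => ?_) k
    -- Second derivatives: the operator `powerDeriv b ψ` applied to `G i`, so only C¹ regularity of
    -- `powerDeriv b` is needed.
    have := integral_weak_product_rule (ContinuousLinearMap.id ℝ
        (EuclideanSpace ℂ (Fin N) →L[ℝ] EuclideanSpace ℂ (Fin N)))
      (A := powerDeriv b) (contDiff_powerDeriv hb3)
      (e := basisVec j) (ψ := fun n => schwartzVec (F n))
      (u := fun n => schwartzVec (fun k => ∂_{basisVec i} (F n k)))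
      (fun n => contDiff_schwartzVec _) (fun n => contDiff_schwartzVec _) hF ae0
      (fun n => by rw [fderiv_schwartzVec_eq]; exact mS _) (h.memLp_grad j)
      (by simpa only [fderiv_schwartzVec] using t1 j) (fun n => mS _) (h.memLp_grad i) (t1 i)
      (fun n => by rw [fderiv_schwartzVec_eq]; exact mS _) (h.memLp_hess i j)
      (by simpa only [fderiv_schwartzVec] using t2 i j) hφ
    simpa only [ContinuousLinearMap.id_apply, fderiv_powerDeriv_apply hb3, Pi.add_apply] using this

theorem HasH2DerivsVec.const_smul (h : HasH2DerivsVec ψ G H) (c : ℝ) :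
    HasH2DerivsVec (fun x => c • ψ x) (fun i x => c • G i x) (fun i j x => c • H i j x) := by
  have key : ∀ {i : Fin 3} {f g : R3 → ℂ}, IsWeakPartial i f g →
      IsWeakPartial i (fun x => c • f x) (fun x => c • g x) := fun {i f g} hw =>
    ⟨hw.1.smul c, hw.2.1.smul c, fun φ hφ => by
      simp only [smul_comm _ c]
      rw [integral_smul, integral_smul, hw.2.2 φ hφ, smul_neg]⟩
  exact fun k => ⟨(h k).memLp.const_smul c,
    fun i => ⟨((h k).grad i).1.const_smul c, key ((h k).grad i).2⟩,
    fun i j => ⟨((h k).hess i j).1.const_smul c, key ((h k).hess i j).2⟩⟩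

theorem HasH2DerivsVec.normH2Vec_const_smul (h : HasH2DerivsVec ψ G H) (c : ℝ) :
    normH2Vec (fun x => c • ψ x) = |c| * normH2Vec ψ := by
  refine (sq_eq_sq₀ (normH2Vec_nonneg _) (mul_nonneg (abs_nonneg _) (normH2Vec_nonneg _))).1 ?_
  rw [(h.const_smul c).normH2Vec_sq, mul_pow, h.normH2Vec_sq]
  simp only [← Finset.smul_sum, l2_const_smul]
  ring

end

end

/-! ### The Lipschitz estimates. -/

/-- `f ∈ L²` with norm at most `B`. -/
def L2Bound (f : R3 → ℝ) (B : ℝ) : Prop := MemLp f 2 ∧ l2 f ≤ B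

namespace L2Bound

theorem add {f g : R3 → ℝ} {B B' : ℝ} (hf : L2Bound f B) (hg : L2Bound g B') :
    L2Bound (fun x => f x + g x) (B + B') :=
  ⟨hf.1.add hg.1, (l2_add_le hf.1 hg.1).trans (add_le_add hf.2 hg.2)⟩

theorem const_mul {f : R3 → ℝ} {B c : ℝ} (hc : 0 ≤ c) (hf : L2Bound f B) :
    L2Bound (fun x => c * f x) (c * B) := by
  refine ⟨hf.1.const_mul c, ?_⟩
  have := l2_const_smul c f
  simp only [smul_eq_mul, abs_of_nonneg hc] at this
  rw [this]
  exact mul_le_mul_of_nonneg_left hf.2 hc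

theorem sum {ι : Type*} {s : Finset ι} {f : ι → R3 → ℝ} {B : ι → ℝ}
    (hf : ∀ i ∈ s, L2Bound (f i) (B i)) : L2Bound (fun x => ∑ i ∈ s, f i x) (∑ i ∈ s, B i) :=
  ⟨memLp_finsetSum _ fun i hi => (hf i hi).1,
    (l2_sum_le fun i hi => (hf i hi).1).trans (Finset.sum_le_sum fun i hi => (hf i hi).2)⟩

theorem norm {X : Type*} [NormedAddCommGroup X] {f : R3 → X} {B : ℝ} (hf : MemLp f 2)
    (hB : l2 f ≤ B) : L2Bound (fun x => ‖f x‖) B :=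
  ⟨hf.norm, (l2_norm f).trans_le hB⟩

theorem mul {f g : R3 → ℝ} {B B' : ℝ} (hf : MemLp f 4) (hg : MemLp g 4) (hB : l4 f ≤ B)
    (hB' : l4 g ≤ B') : L2Bound (fun x => f x * g x) (B * B') :=
  ⟨memLp_two_mul hf hg, (l2_mul_le hf hg).trans
    (mul_le_mul hB hB' (l4_nonneg _) ((l4_nonneg _).trans hB))⟩

theorem l2_le {X : Type*} [NormedAddCommGroup X] {f : R3 → X} {g : R3 → ℝ} {B : ℝ}
    (hg : L2Bound g B) (h : ∀ᵐ x, ‖f x‖ ≤ g x) : l2 f ≤ B :=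
  (l2_le_of_ae_norm_le hg.1 (h.mono fun _ hx => hx.trans (Real.le_norm_self _))).trans hg.2

end L2Bound

section
variable {V : Type*} [NormedAddCommGroup V] [InnerProductSpace ℝ V]

/-- Pointwise Lipschitz bound for the Laplacian of `|ψ|^b ψ` in terms of the jets of `ψ`. -/
theorem norm_trace_powerDeriv_sub_le {b M δ : ℝ} (hb : 5 ≤ b) {z w : V} {g g' : Fin 3 → V}
    {h h' : Fin 3 → V} (hz : ‖z‖ ≤ M) (hw : ‖w‖ ≤ M) (hδ : ‖z - w‖ ≤ δ) :
    ‖∑ i, (powerDeriv2 b z (g i) (g i) + powerDeriv b z (h i)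
        - (powerDeriv2 b w (g' i) (g' i) + powerDeriv b w (h' i)))‖ ≤
      ((b + 1) ^ 3 * M ^ (b - 5)) * (M ^ 4 * δ * (‖∑ i, h i‖ + ‖∑ i, h' i‖)
        + M ^ 5 * ‖∑ i, (h i - h' i)‖
        + ∑ i, (M ^ 3 * δ * ((‖g i‖ + ‖g' i‖) * (‖g i‖ + ‖g' i‖))
          + M ^ 4 * ((‖g i‖ + ‖g' i‖) * ‖g i - g' i‖))) := by
  have hM : 0 ≤ M := (norm_nonneg _).trans hz
  -- `powerDeriv b z` is linear, so the sum over `i` moves inside: second derivatives enter only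
  -- through their trace, the Laplacian, which the H² norm controls.
  have e : ∑ i, (powerDeriv2 b z (g i) (g i) + powerDeriv b z (h i)
        - (powerDeriv2 b w (g' i) (g' i) + powerDeriv b w (h' i)))
      = (powerDeriv b z (∑ i, h i) - powerDeriv b w (∑ i, h' i))
        + ∑ i, (powerDeriv2 b z (g i) (g i) - powerDeriv2 b w (g' i) (g' i)) := by
    simp only [Finset.sum_sub_distrib, Finset.sum_add_distrib, map_sum]
    abel
  rw [e, mul_add]
  refine (norm_add_le _ _).trans (add_le_add ?_ ?_)
  · refine (norm_powerDeriv_sub_le hb hz hw).trans ?_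
    rw [Finset.sum_sub_distrib]
    gcongr
  · rw [Finset.mul_sum]
    refine (norm_sum_le _ _).trans (Finset.sum_le_sum fun i _ => ?_)
    refine (norm_powerDeriv2_sub_le hb hz hw).trans ?_
    rw [← pow_two]
    gcongr

end

section
variable {N : ℕ} {ψ ψ' : R3 → EuclideanSpace ℂ (Fin N)}
  {G G' : Fin 3 → R3 → EuclideanSpace ℂ (Fin N)}
  {H H' : Fin 3 → Fin 3 → R3 → EuclideanSpace ℂ (Fin N)}

/-- The power nonlinearity is locally Lipschitz on `(H²)^N`, given the constant `C` of the
embeddings `H² ⊂ L^∞` and `∇H² ⊂ L⁴`. -/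
theorem normH2Vec_norm_rpow_smul_sub_le {b C R : ℝ} (hb : 5 ≤ b) (hC : 0 < C)
    (hemb : ∀ (φ : R3 → EuclideanSpace ℂ (Fin N)) G H, HasH2DerivsVec φ G H →
      (∀ᵐ x, ‖φ x‖ ≤ C * normH2Vec φ) ∧ ∀ i, MemLp (G i) 4 ∧ l4 (G i) ≤ C * normH2Vec φ)
    (h : HasH2DerivsVec ψ G H) (h' : HasH2DerivsVec ψ' G' H') (hR : normH2Vec ψ ≤ R)
    (hR' : normH2Vec ψ' ≤ R) :
    normH2Vec (fun x => ‖ψ x‖ ^ b • ψ x - ‖ψ' x‖ ^ b • ψ' x) ≤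
      ((b + 2) + (b + 1) ^ 3 * (3 + 18 * C)) * C ^ b * R ^ b
        * normH2Vec (fun x => ψ x - ψ' x) := by
  have hR0 : 0 ≤ R := (normH2Vec_nonneg _).trans hR
  obtain ⟨s, hg⟩ := hemb _ _ _ h
  obtain ⟨s', hg'⟩ := hemb _ _ _ h'
  obtain ⟨sd, hgd⟩ := hemb _ _ _ (h.sub h')
  set D := normH2Vec (fun x => ψ x - ψ' x) with hD
  have hD0 : 0 ≤ D := normH2Vec_nonneg _
  set M := C * R with hMdef
  have hM0 : 0 ≤ M := by positivity
  have hM : ∀ᵐ x, ‖ψ x‖ ≤ M := s.mono fun _ hx =>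
    hx.trans (mul_le_mul_of_nonneg_left hR hC.le)
  have hM' : ∀ᵐ x, ‖ψ' x‖ ≤ M := s'.mono fun _ hx =>
    hx.trans (mul_le_mul_of_nonneg_left hR' hC.le)
  have h4 := fun i => (hg i).2.trans (mul_le_mul_of_nonneg_left hR hC.le)
  have h4' := fun i => (hg' i).2.trans (mul_le_mul_of_nonneg_left hR' hC.le)
  have B1 : l2 (fun x => ‖ψ x‖ ^ b • ψ x - ‖ψ' x‖ ^ b • ψ' x) ≤ (b + 2) * M ^ b * D := by
    refine ((L2Bound.norm (h.memLp.sub h'.memLp) (h.sub h').l2_le).const_mul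
      (c := (b + 2) * M ^ b) (by positivity)).l2_le ?_
    filter_upwards [hM, hM'] with x hx hx'
    exact norm_rpow_smul_sub_le (by linarith) hx hx'
  have gb : ∀ i, MemLp (fun x => ‖G i x‖ + ‖G' i x‖) 4 ∧ l4 (fun x => ‖G i x‖ + ‖G' i x‖) ≤ 2 * M :=
    fun i => ⟨(hg i).1.norm.add (hg' i).1.norm, by
      refine (l4_add_le (hg i).1.norm (hg' i).1.norm).trans ?_
      rw [l4_norm, l4_norm, two_mul]
      exact add_le_add (h4 i) (h4' i)⟩
  -- L² bound for the pointwise majorant with `δ = C * D`: Laplacians are measured in L², gradient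
  -- products by Hölder from L⁴ × L⁴, and `ψ - ψ'` in the sup norm.
  have B2 := ((((L2Bound.norm h.memLp_trace (h.l2_trace_le.trans hR)).add
      (L2Bound.norm h'.memLp_trace (h'.l2_trace_le.trans hR'))).const_mul
        (c := M ^ 4 * (C * D)) (by positivity)).add
      ((L2Bound.norm (h.sub h').memLp_trace (h.sub h').l2_trace_le).const_mul
        (c := M ^ 5) (by positivity))).add
      (L2Bound.sum (s := Finset.univ) fun i _ =>
        ((L2Bound.mul (gb i).1 (gb i).1 (gb i).2 (gb i).2).const_mul
          (c := M ^ 3 * (C * D)) (by positivity)).add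
        ((L2Bound.mul (gb i).1 (hgd i).1.norm (gb i).2
          ((l4_norm _).trans_le (hgd i).2)).const_mul (c := M ^ 4) (by positivity)))
  have B3 := (B2.const_mul (c := (b + 1) ^ 3 * M ^ (b - 5)) (by positivity)).l2_le
    (f := fun x => ∑ i, (powerDeriv2 b (ψ x) (G i x) (G i x) + powerDeriv b (ψ x) (H i i x)
        - (powerDeriv2 b (ψ' x) (G' i x) (G' i x) + powerDeriv b (ψ' x) (H' i i x)))) (by
    filter_upwards [hM, hM', sd] with x hx hx' hd
    exact norm_trace_powerDeriv_sub_le hb hx hx' hd)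
  have hP := (h.norm_rpow_smul hb hM fun i => (hg i).1).sub
    (h'.norm_rpow_smul hb hM' fun i => (hg' i).1)
  have hpow : M ^ b = M ^ (b - 5) * M ^ 5 := by
    rw [← Real.rpow_natCast, ← Real.rpow_add_of_nonneg hM0 (by linarith) (by norm_num)]
    congr 1; push_cast; ring
  have hpow' : M ^ b = C ^ b * R ^ b := Real.mul_rpow hC.le hR0
  refine (hP.normH2Vec_le.trans (add_le_add B1 B3)).trans (le_of_eq ?_)
  rw [mul_assoc (_ + _) (C ^ b), ← hpow', hpow]
  -- With `M = C * R` the Laplacian terms add up to `(2 + 1) * M ^ 5 * D`, and the three gradient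
  -- terms to `3 * (4 + 2) * C * M ^ 5 * D`; hence `3 + 18 * C`.
  simp only [Finset.sum_const, Finset.card_univ, Fintype.card_fin, nsmul_eq_mul]
  rw [← hD]
  rw [show M ^ 5 = M ^ 4 * (C * R) by rw [← hMdef]; ring]
  rw [show M ^ 4 = M ^ 3 * (C * R) by rw [← hMdef]; ring]
  rw [hMdef]
  push_cast
  ring

theorem localNonlinearity_eq (q lam : ℝ) (ψ : R3 → EuclideanSpace ℂ (Fin N)) :
    localNonlinearity q lam ψ = fun x => lam • (‖ψ x‖ ^ (2 * (q - 1)) • ψ x) := by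
  ext1 x
  rw [localNonlinearity, exchangePotential, density, ← EuclideanSpace.norm_sq_eq, smul_smul,
    ← Real.rpow_natCast, ← Real.rpow_mul (norm_nonneg _)]
  norm_num

/-- The origin of the power of `N`: the density is a sum of `N` terms raised to the power `q - 1`,
which yields the exponent `max (q - 2) 0`. -/
theorem norm_rpow_le_card_rpow_mul_sum {q C : ℝ} (hq : 1 ≤ q) (hC : 0 ≤ C) (hN : 0 < N)
    {z : EuclideanSpace ℂ (Fin N)} {a : Fin N → ℝ} (ha : ∀ j, 0 ≤ a j) (hz : ∀ j, ‖z j‖ ≤ C * a j) :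
    ‖z‖ ^ (2 * (q - 1)) ≤
      C ^ (2 * (q - 1)) * (N : ℝ) ^ max (q - 2) 0 * ∑ j, a j ^ (2 * (q - 1)) := by
  have e : ∀ r : ℝ, 0 ≤ r → r ^ (2 * (q - 1)) = (r ^ 2) ^ (q - 1) := fun r hr => by
    rw [← Real.rpow_natCast, ← Real.rpow_mul hr]; norm_num
  have hm : max (q - 1 - 1) 0 = max (q - 2) 0 := by ring_nf
  rw [e _ (norm_nonneg _), EuclideanSpace.norm_sq_eq]
  refine (sum_rpow_le_card_rpow_mul _ (fun j => sq_nonneg _) hN (by linarith)).trans ?_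
  rw [hm, mul_comm (C ^ _), mul_assoc]
  refine mul_le_mul_of_nonneg_left ?_ (by positivity)
  rw [Finset.mul_sum]
  refine Finset.sum_le_sum fun j _ => ?_
  rw [← e _ (norm_nonneg _), ← Real.mul_rpow hC (ha j)]
  exact Real.rpow_le_rpow (norm_nonneg _) (hz j) (by linarith)

theorem norm_rpow_smul_sub_le_add {b : ℝ} (hb : 0 ≤ b) {V : Type*} [NormedAddCommGroup V]
    [NormedSpace ℝ V] (z w : V) :
    ‖‖z‖ ^ b • z - ‖w‖ ^ b • w‖ ≤ (b + 2) * (‖z‖ ^ b + ‖w‖ ^ b) * ‖z - w‖ := by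
  refine (norm_rpow_smul_sub_le hb (le_max_left ‖z‖ ‖w‖) (le_max_right _ _)).trans ?_
  have h1 := Real.rpow_nonneg (norm_nonneg z) b
  have h2 := Real.rpow_nonneg (norm_nonneg w) b
  have h3 : max ‖z‖ ‖w‖ ^ b ≤ ‖z‖ ^ b + ‖w‖ ^ b := by
    rcases max_choice ‖z‖ ‖w‖ with h | h <;> rw [h] <;> linarith
  gcongr

theorem memLp_localNonlinearity {q lam C : ℝ} (hq : 1 ≤ q) {p : ℝ≥0∞} (hψ : MemLp ψ p)
    (hC : ∀ᵐ x, ‖ψ x‖ ≤ C) : MemLp (localNonlinearity q lam ψ) p := by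
  rw [localNonlinearity_eq]
  refine MemLp.const_smul (hψ.of_le_mul (c := C ^ (2 * (q - 1)))
    (aestronglyMeasurable_norm_rpow_smul (by linarith) hψ.1) ?_) lam
  filter_upwards [hC] with x hx
  rw [norm_smul, Real.norm_of_nonneg (by positivity)]
  exact mul_le_mul_of_nonneg_right (Real.rpow_le_rpow (norm_nonneg _) hx (by linarith))
    (norm_nonneg _)

theorem normLp_localNonlinearity_sub_le {q C : ℝ} (lam : ℝ) (hq : 1 ≤ q) (hC : 0 < C)
    (hemb : ∀ f : R3 → ℂ, MemH2 f → ∀ᵐ x, ‖f x‖ ≤ C * normH2 f) {p : ℝ≥0∞}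
    (h : MemH2Vec ψ) (h' : MemH2Vec ψ') (hp : MemLp ψ p) (hp' : MemLp ψ' p) :
    normLp p (fun x => localNonlinearity q lam ψ x - localNonlinearity q lam ψ' x) ≤
      (|lam| + 1) * (2 * (q - 1) + 2) * C ^ (2 * (q - 1)) * (N : ℝ) ^ max (q - 2) 0 *
        (∑ j, (normH2 (fun x => ψ x j) ^ (2 * (q - 1)) +
          normH2 (fun x => ψ' x j) ^ (2 * (q - 1)))) * normLp p (fun x => ψ x - ψ' x) := by
  set b := 2 * (q - 1) with hb
  have hb0 : 0 ≤ b := by rw [hb]; linarith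
  set S := ∑ j, (normH2 (fun x => ψ x j) ^ b + normH2 (fun x => ψ' x j) ^ b) with hS
  have hS0 : 0 ≤ S := Finset.sum_nonneg fun j _ =>
    add_nonneg (Real.rpow_nonneg (normH2_nonneg _) _) (Real.rpow_nonneg (normH2_nonneg _) _)
  set K := (|lam| + 1) * (b + 2) * C ^ b * (N : ℝ) ^ max (q - 2) 0 * S with hK
  have hK0 : 0 ≤ K := by positivity
  have key : ∀ᵐ x, ‖localNonlinearity q lam ψ x - localNonlinearity q lam ψ' x‖
      ≤ K * ‖ψ x - ψ' x‖ := by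
    -- `N = 0` is separated because the inequality for powers of sums fails there when `q = 1`.
    rcases Nat.eq_zero_or_pos N with rfl | hN
    · exact Filter.Eventually.of_forall fun x => by
        rw [Subsingleton.elim (localNonlinearity q lam ψ x - localNonlinearity q lam ψ' x)
          (0 : EuclideanSpace ℂ (Fin 0)),
          norm_zero]
        positivity
    filter_upwards [ae_all_iff.2 fun j => hemb _ (h j), ae_all_iff.2 fun j => hemb _ (h' j)]
      with x hx hx'
    simp only [localNonlinearity_eq, ← smul_sub, ← hb]
    rw [norm_smul, Real.norm_eq_abs]
    have n1 := norm_rpow_le_card_rpow_mul_sum hq hC.le hN (fun j => normH2_nonneg _) hx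
    have n2 := norm_rpow_le_card_rpow_mul_sum hq hC.le hN (fun j => normH2_nonneg _) hx'
    have n3 := norm_rpow_smul_sub_le_add hb0 (ψ x) (ψ' x)
    have n4 : ‖ψ x‖ ^ b + ‖ψ' x‖ ^ b ≤ C ^ b * (N : ℝ) ^ max (q - 2) 0 * S := by
      rw [hS, Finset.sum_add_distrib, mul_add]
      exact add_le_add n1 n2
    calc |lam| * ‖‖ψ x‖ ^ b • ψ x - ‖ψ' x‖ ^ b • ψ' x‖
        ≤ (|lam| + 1) * ((b + 2) * (C ^ b * (N : ℝ) ^ max (q - 2) 0 * S) * ‖ψ x - ψ' x‖) := by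
          refine mul_le_mul (by linarith) (n3.trans ?_) (norm_nonneg _) (by positivity)
          gcongr
      _ = K * ‖ψ x - ψ' x‖ := by rw [hK]; ring
  -- `K` does not depend on `x`, so the pointwise bound passes to every `p`, including `⊤`.
  have := eLpNorm_le_mul_eLpNorm_of_ae_le_mul key p
  rw [normLp, normLp]
  refine (ENNReal.toReal_mono (ENNReal.mul_ne_top ENNReal.ofReal_ne_top (hp.sub hp').2.ne)
    this).trans_eq ?_
  rw [ENNReal.toReal_mul, ENNReal.toReal_ofReal hK0]
  rfl

end

/-! ### Assembly of the two statements. -/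

theorem mainTheorem2 :
    (∀ q lam : ℝ, 1 ≤ q →
      ∃ C : ℝ, 0 < C ∧
        ∀ (N : ℕ) (p : ℝ≥0∞), 1 ≤ p →
        ∀ ψ ψ' : R3 → EuclideanSpace ℂ (Fin N),
          MemH2Vec ψ → MemLp ψ p volume → MemH2Vec ψ' → MemLp ψ' p volume →
          MemLp (localNonlinearity q lam ψ) p volume ∧
          MemLp (localNonlinearity q lam ψ') p volume ∧
          normLp p (fun x => localNonlinearity q lam ψ x - localNonlinearity q lam ψ' x) ≤
            C * (N : ℝ) ^ max (q - 2) 0 *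
              (∑ j, (normH2 (fun x => ψ x j) ^ (2 * (q - 1)) +
                normH2 (fun x => ψ' x j) ^ (2 * (q - 1)))) *
              normLp p (fun x => ψ x - ψ' x)) ∧
    (∀ q lam : ℝ, 7 / 2 ≤ q →
      ∃ L : ℝ → ℝ, MonotoneOn L (Set.Ici 0) ∧ (∀ s, 0 ≤ s → 0 ≤ L s) ∧
        (∀ s, 0 ≤ s → (L s = 0 ↔ s = 0)) ∧
        ∀ (N : ℕ) (ψ ψ' : R3 → EuclideanSpace ℂ (Fin N)),
          MemH2Vec ψ → MemH2Vec ψ' →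
          MemH2Vec (localNonlinearity q lam ψ) ∧
          MemH2Vec (localNonlinearity q lam ψ') ∧
          normH2Vec (fun x => localNonlinearity q lam ψ x - localNonlinearity q lam ψ' x) ≤
            L (max (normH2Vec ψ) (normH2Vec ψ')) * normH2Vec (fun x => ψ x - ψ' x)) := by

  obtain ⟨C, hC, hsup, hemb⟩ := exists_h2Vec_bounds
  have hbdd : ∀ {N : ℕ} {ψ : R3 → EuclideanSpace ℂ (Fin N)}, MemH2Vec ψ →
      ∃ M, ∀ᵐ x, ‖ψ x‖ ≤ M := fun {N ψ} h => by
    obtain ⟨G, H, hGH⟩ := memH2Vec_iff.1 h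
    exact ⟨_, (hemb N ψ G H hGH).1⟩
  refine ⟨fun q lam hq => ?_, fun q lam hq => ?_⟩
  · have hb : 0 ≤ 2 * (q - 1) := by linarith
    -- `|lam| + 1` in place of `|lam|` keeps the constant positive when `lam = 0`.
    refine ⟨(|lam| + 1) * (2 * (q - 1) + 2) * C ^ (2 * (q - 1)), by positivity, ?_⟩
    intro N p _ ψ ψ' h hp h' hp'
    obtain ⟨M, hM⟩ := hbdd h
    obtain ⟨M', hM'⟩ := hbdd h'
    exact ⟨memLp_localNonlinearity hq hp hM, memLp_localNonlinearity hq hp' hM',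
      normLp_localNonlinearity_sub_le lam hq hC hsup h h' hp hp'⟩
  · have hb : 5 ≤ 2 * (q - 1) := by linarith
    set b := 2 * (q - 1) with hbdef
    -- Positivity of `K`, even for `lam = 0`, makes `K * s ^ b` vanish only at the origin.
    set K := (|lam| + 1) * (((b + 2) + (b + 1) ^ 3 * (3 + 18 * C)) * C ^ b) with hK
    have hK0 : 0 < K := by positivity
    refine ⟨fun s => K * s ^ b, fun s hs t _ hst => ?_, fun s hs => by positivity, fun s hs => ?_,
      fun N ψ ψ' hψ hψ' => ?_⟩
    · exact mul_le_mul_of_nonneg_left (Real.rpow_le_rpow hs hst (by linarith)) hK0.le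
    · rw [mul_eq_zero, or_iff_right hK0.ne', Real.rpow_eq_zero hs (by linarith)]
    obtain ⟨G, H, h⟩ := memH2Vec_iff.1 hψ
    obtain ⟨G', H', h'⟩ := memH2Vec_iff.1 hψ'
    obtain ⟨s, hg⟩ := hemb N _ _ _ h
    obtain ⟨s', hg'⟩ := hemb N _ _ _ h'
    have hP := h.norm_rpow_smul hb s fun i => (hg i).1
    have hP' := h'.norm_rpow_smul hb s' fun i => (hg' i).1
    simp only [localNonlinearity_eq, ← hbdef]
    refine ⟨memH2Vec_iff.2 ⟨_, _, hP.const_smul lam⟩, memH2Vec_iff.2 ⟨_, _, hP'.const_smul lam⟩, ?_⟩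
    simp only [← smul_sub]
    rw [(hP.sub hP').normH2Vec_const_smul lam]
    have key := normH2Vec_norm_rpow_smul_sub_le hb hC (hemb N) h h'
      (le_max_left (normH2Vec ψ) (normH2Vec ψ')) (le_max_right _ _)
    calc _ ≤ (|lam| + 1) * _ :=
          mul_le_mul (by linarith) key (normH2Vec_nonneg _) (by positivity)
      _ = _ := by rw [hK]; ring
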